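/- Let $X$ be a smooth $n$-dimensional riemannian manifold, $1\le p\le n$, and let $\pi:G(p,TX)\to X$ be the Grassmann bundle of $p$-dimensional subspaces of the tangent spaces of $X$. Let $\mathbf G\subset G(p,TX)$ be a closed subset, with fibres $\mathbf G_x=\mathbf G\cap\pi^{-1}(x)$, which admits a smooth neighborhood retraction preserving the fibres of $\pi$: there are an open set $U\supset\mathbf G$ in $G(p,TX)$ and a smooth map $\rho:U\to G(p,TX)$ with $\rho(U)\subset\mathbf G$, $\rho|_{\mathbf G}=\mathrm{id}$ and $\pi\circ\rho=\pi$. For an upper semicontinuous function $u:X\to[-\infty,\infty)$, a test function for $u$ at $x$ is a $C^2$ function $\varphi$ defined near $x$ with $u\le\varphi$ near $x$ and $u(x)=\varphi(x)$. The function $u$ is called $\mathbf G$-plurisubharmonic if for every $x\in X$ and every test function $\varphi$ for $u$ at $x$ the riemannian Hessian satisfies $\mathrm{tr}_W\,\mathrm{Hess}_x\varphi\ge 0$ for all $W\in\mathbf G_x$, where $\mathrm{tr}_W$ is the trace of the restriction to $W$. A minimal $\mathbf G$-submanifold is a smooth (immersed) $p$-dimensional submanifold $M$ of $X$ with $T_xM\in\mathbf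 G_x$ for all $x\in M$ and with vanishing mean curvature vector. **Theorem (Restriction).** If $u$ is $\mathbf G$-plurisubharmonic, then for every minimal $\mathbf G$-submanifold $M$ the restriction $u|_M$ is $\Delta$-subharmonic, where $\Delta$ is the Laplace–Beltrami operator of the induced riemannian metric on $M$; that is, $u|_M$ is upper semicontinuous with values in $[-\infty,\infty)$, and $(\Delta\varphi)(x)\ge 0$ for every $x\in M$ and every test function $\varphi$ for $u|_M$ at $x$. -/

import Mathlib

set_option maxSynthPendingDepth 3

open Set Filter Topology Manifold
open scoped ContDiff

noncomputable section

namespace Pluri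

/-! ### Linear algebra of bilinear forms -/

section LinearAlgebra

variable {V W : Type*}
  [AddCommGroup V] [Module ℝ V] [TopologicalSpace V] [IsTopologicalAddGroup V]
  [ContinuousConstSMul ℝ V]
  [AddCommGroup W] [Module ℝ W] [TopologicalSpace W] [IsTopologicalAddGroup W]
  [ContinuousConstSMul ℝ W]

/-- The pull-back `(v, w) ↦ A (L v) (L w)` of a bilinear form. -/
def pullback (A : V →L[ℝ] V →L[ℝ] ℝ) (L : W →L[ℝ] V) : W →L[ℝ] W →L[ℝ] ℝ :=
  (ContinuousLinearMap.precomp ℝ L).comp (A.comp L)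

@[simp] theorem pullback_apply (A : V →L[ℝ] V →L[ℝ] ℝ) (L : W →L[ℝ] V) (v w : W) :
    pullback A L v w = A (L v) (L w) := rfl

/-- The trace of the bilinear form `A` with respect to the inner product `b`, i.e. the trace of the
endomorphism `S` with `b (S v) w = A v w` (equivalently, `∑ i, A (e i) (e i)` over a
`b`-orthonormal basis `e`).  For `b` positive definite on a finite-dimensional space the map
`b : V → V*` is invertible, and `S = b⁻¹ ∘ A`. -/
def traceWrt (b A : V →L[ℝ] V →L[ℝ] ℝ) : ℝ :=
  LinearMap.trace ℝ V (b.inverse.comp A : V →L[ℝ] V)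

/-- The `S`-trace of `A`: the trace of the restriction of `A` to the subspace `S`, with respect to
the restriction of the inner product `b`. -/
def traceOn (b : V →L[ℝ] V →L[ℝ] ℝ) (S : Submodule ℝ V) (A : V →L[ℝ] V →L[ℝ] ℝ) : ℝ :=
  traceWrt (pullback b S.subtypeL) (pullback A S.subtypeL)

/-- The orthogonal projection `V → V` onto the subspace `S` with respect to the inner product `b`:
`v` is sent to the element of `S` which represents the functional `b v` restricted to `S`. -/
def orthProj (b : V →L[ℝ] V →L[ℝ] ℝ) (S : Submodule ℝ V) : V →L[ℝ] V :=
  S.subtypeL.comp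
    ((pullback b S.subtypeL).inverse.comp ((ContinuousLinearMap.precomp ℝ S.subtypeL).comp b))

end LinearAlgebra

/-! ### Riemannian calculus in coordinates

`G : E → E →L[ℝ] E →L[ℝ] ℝ` is a Riemannian metric on (an open subset of) the vector space `E`. -/

section Coordinates

variable {E : Type*} [NormedAddCommGroup E] [NormedSpace ℝ E]

/-- The Christoffel symbols of the first kind,
`(v, w, z) ↦ ½ (∂_v G(w, z) + ∂_w G(v, z) - ∂_z G(v, w))` at the point `y`. -/
def koszul (G : E → E →L[ℝ] E →L[ℝ] ℝ) (y : E) : E →L[ℝ] E →L[ℝ] E →L[ℝ] ℝ :=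
  let D : E →L[ℝ] E →L[ℝ] E →L[ℝ] ℝ := fderiv ℝ G y
  let T : E →L[ℝ] E →L[ℝ] E →L[ℝ] ℝ :=
    ((ContinuousLinearMap.flipₗᵢ ℝ E E ℝ).toContinuousLinearEquiv.toContinuousLinearMap).comp D.flip
  (1 / 2 : ℝ) • (D + D.flip - T)

theorem koszul_apply (G : E → E →L[ℝ] E →L[ℝ] ℝ) (y v w z : E) :
    koszul G y v w z =
      (1 / 2 : ℝ) * (fderiv ℝ G y v w z + fderiv ℝ G y w v z - fderiv ℝ G y z v w) := rfl

/-- The Christoffel symbols of the second kind (the Levi-Civita connection in coordinates):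
`Γ(v, w)` is the vector with `G(Γ(v, w), z) = ½ (∂_v G(w, z) + ∂_w G(v, z) - ∂_z G(v, w))`. -/
def christoffel (G : E → E →L[ℝ] E →L[ℝ] ℝ) (y : E) : E →L[ℝ] E →L[ℝ] E :=
  (ContinuousLinearMap.postcomp E (G y).inverse).comp (koszul G y)

theorem christoffel_apply (G : E → E →L[ℝ] E →L[ℝ] ℝ) (y v w : E) :
    christoffel G y v w = (G y).inverse (koszul G y v w) := rfl

/-- The Riemannian Hessian in coordinates, `(v, w) ↦ D²f(v, w) - Df(Γ(v, w))`. -/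
def coordHessian (G : E → E →L[ℝ] E →L[ℝ] ℝ) (f : E → ℝ) (y : E) : E →L[ℝ] E →L[ℝ] ℝ :=
  fderiv ℝ (fderiv ℝ f) y - (ContinuousLinearMap.postcomp E (fderiv ℝ f y)).comp (christoffel G y)

theorem coordHessian_apply (G : E → E →L[ℝ] E →L[ℝ] ℝ) (f : E → ℝ) (y v w : E) :
    coordHessian G f y v w =
      fderiv ℝ (fderiv ℝ f) y v w - fderiv ℝ f y (christoffel G y v w) := rfl

end Coordinates

/-! ### Riemannian manifolds: Hessian and Laplace–Beltrami operator -/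

section Manifold

variable {E : Type*} [NormedAddCommGroup E] [NormedSpace ℝ E]
  {X : Type*} [TopologicalSpace X] [ChartedSpace E X]

/-- The coordinate expression, in the chart `c`, of a field `B` of bilinear forms on the tangent
spaces: `(v, w) ↦ B (∂_v, ∂_w)`, where `∂_v` is the coordinate vector field given by `v`. -/
def metricInChart (c : OpenPartialHomeomorph X E)
    (B : ∀ x : X, TangentSpace 𝓘(ℝ, E) x →L[ℝ] TangentSpace 𝓘(ℝ, E) x →L[ℝ] ℝ) (y : E) :
    E →L[ℝ] E →L[ℝ] ℝ :=
  pullback (W := E) (B (c.symm y)) (mfderiv 𝓘(ℝ, E) 𝓘(ℝ, E) c.symm y)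

/-- The Riemannian Hessian at `x` of the function `φ` for the metric `B`, as a bilinear form on the
tangent space at `x`, computed in the chart `c` around `x`.  (For a `C²` function it does not
depend on the chart.) -/
def hessian (c : OpenPartialHomeomorph X E)
    (B : ∀ x : X, TangentSpace 𝓘(ℝ, E) x →L[ℝ] TangentSpace 𝓘(ℝ, E) x →L[ℝ] ℝ)
    (φ : X → ℝ) (x : X) :
    TangentSpace 𝓘(ℝ, E) x →L[ℝ] TangentSpace 𝓘(ℝ, E) x →L[ℝ] ℝ :=
  pullback (V := E) (coordHessian (metricInChart c B) (φ ∘ c.symm) (c x))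
    (mfderiv 𝓘(ℝ, E) 𝓘(ℝ, E) c x)

/-- The Laplace–Beltrami operator of the metric `B`: the trace of the Hessian. -/
def laplacian (c : OpenPartialHomeomorph X E)
    (B : ∀ x : X, TangentSpace 𝓘(ℝ, E) x →L[ℝ] TangentSpace 𝓘(ℝ, E) x →L[ℝ] ℝ)
    (φ : X → ℝ) (x : X) : ℝ :=
  traceWrt (B x) (hessian c B φ x)

/-- `φ` is a (viscosity) test function for `u` at `x`: it is `C²` near `x`, `u ≤ φ` near `x`, and
`u x = φ x`. -/
structure IsTestFunction (u : X → EReal) (φ : X → ℝ) (x : X) : Prop where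
  contMDiffAt : ContMDiffAt 𝓘(ℝ, E) 𝓘(ℝ, ℝ) 2 φ x
  le : ∀ᶠ y in 𝓝 x, u y ≤ (φ y : EReal)
  eq : u x = (φ x : EReal)

/-- An upper semicontinuous `[-∞, ∞)`-valued function. -/
structure IsUSC {Y : Type*} [TopologicalSpace Y] (u : Y → EReal) : Prop where
  upperSemicontinuous : UpperSemicontinuous u
  ne_top : ∀ y, u y ≠ ⊤

/-- `u` is subharmonic for the Laplace–Beltrami operator of the metric `B`, in the viscosity sense.
The (chart independent) Laplacian may be computed in any chart of the atlas. -/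
structure IsSubharmonic
    (B : ∀ x : X, TangentSpace 𝓘(ℝ, E) x →L[ℝ] TangentSpace 𝓘(ℝ, E) x →L[ℝ] ℝ)
    (u : X → EReal) : Prop where
  usc : IsUSC u
  laplacian_nonneg : ∀ (x : X) (φ : X → ℝ), IsTestFunction (E := E) u φ x →
    ∀ c ∈ atlas E X, x ∈ c.source → 0 ≤ laplacian c B φ x

/-! ### The Grassmann bundle -/

variable (E X) in
/-- The Grassmann bundle `G(p, TX)`: its points are the `p`-dimensional subspaces of the tangent
spaces of `X`. -/
structure GrassmannBundle (p : ℕ) where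
  base : X
  plane : Submodule ℝ (TangentSpace 𝓘(ℝ, E) base)
  finrank_plane : Module.finrank ℝ plane = p

/-- The fibre over `x` of a subset `𝒢` of the Grassmann bundle. -/
def fibre {p : ℕ} (𝒢 : Set (GrassmannBundle E X p)) (x : X) :
    Set (Submodule ℝ (TangentSpace 𝓘(ℝ, E) x)) :=
  {W | ∃ h : Module.finrank ℝ W = p, (⟨x, W, h⟩ : GrassmannBundle E X p) ∈ 𝒢}

variable [IsManifold 𝓘(ℝ, E) ∞ X]

/-- The embedding of the Grassmann bundle into the vector bundle `End(TX)`, which sends a plane to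
the orthogonal projection onto it. -/
def grassmannEmbedding
    (g : Bundle.ContMDiffRiemannianMetric 𝓘(ℝ, E) ∞ E (fun x : X => TangentSpace 𝓘(ℝ, E) x)) (p : ℕ)
    (z : GrassmannBundle E X p) :
    Bundle.TotalSpace (E →L[ℝ] E)
      (fun x : X => TangentSpace 𝓘(ℝ, E) x →L[ℝ] TangentSpace 𝓘(ℝ, E) x) :=
  ⟨z.base, orthProj (g.inner z.base) z.plane⟩

/-- The topology of the Grassmann bundle (as a submanifold of `End(TX)`). -/
@[reducible] def grassmannTopology
    (g : Bundle.ContMDiffRiemannianMetric 𝓘(ℝ, E) ∞ E (fun x : X => TangentSpace 𝓘(ℝ, E) x)) (p : ℕ) :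
    TopologicalSpace (GrassmannBundle E X p) :=
  TopologicalSpace.induced (grassmannEmbedding g p) inferInstance

/-- The map `ρ` of the Grassmann bundle is smooth on `U`, where the smooth structure is that of a
submanifold of `End(TX)`. -/
def GrassmannSmoothOn
    (g : Bundle.ContMDiffRiemannianMetric 𝓘(ℝ, E) ∞ E (fun x : X => TangentSpace 𝓘(ℝ, E) x)) {p : ℕ}
    (ρ : GrassmannBundle E X p → GrassmannBundle E X p) (U : Set (GrassmannBundle E X p)) : Prop :=
  ∃ R : Bundle.TotalSpace (E →L[ℝ] E)
        (fun x : X => TangentSpace 𝓘(ℝ, E) x →L[ℝ] TangentSpace 𝓘(ℝ, E) x) →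
      Bundle.TotalSpace (E →L[ℝ] E)
        (fun x : X => TangentSpace 𝓘(ℝ, E) x →L[ℝ] TangentSpace 𝓘(ℝ, E) x),
    ContMDiffOn (𝓘(ℝ, E).prod 𝓘(ℝ, E →L[ℝ] E)) (𝓘(ℝ, E).prod 𝓘(ℝ, E →L[ℝ] E)) ∞ R
      (grassmannEmbedding g p '' U) ∧
    ∀ z ∈ U, R (grassmannEmbedding g p z) = grassmannEmbedding g p (ρ z)

/-- `𝒢` admits a smooth neighborhood retraction which preserves the fibres of the projection
`G(p, TX) → X`. -/
def HasSmoothFibrewiseRetraction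
    (g : Bundle.ContMDiffRiemannianMetric 𝓘(ℝ, E) ∞ E (fun x : X => TangentSpace 𝓘(ℝ, E) x)) {p : ℕ}
    (𝒢 : Set (GrassmannBundle E X p)) : Prop :=
  ∃ (U : Set (GrassmannBundle E X p)) (ρ : GrassmannBundle E X p → GrassmannBundle E X p),
    IsOpen[grassmannTopology g p] U ∧ 𝒢 ⊆ U ∧ GrassmannSmoothOn g ρ U ∧
    (∀ z ∈ U, ρ z ∈ 𝒢) ∧ (∀ z ∈ 𝒢, ρ z = z) ∧ (∀ z ∈ U, (ρ z).base = z.base)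

/-- `𝒢`-plurisubharmonic functions in the viscosity sense: `tr_W Hess_x φ ≥ 0` for every test
function `φ` for `u` at `x` and every `W ∈ 𝒢_x`.
The (chart independent) Hessian may be computed in any chart of the atlas. -/
structure IsPlurisubharmonic
    (g : Bundle.ContMDiffRiemannianMetric 𝓘(ℝ, E) ∞ E (fun x : X => TangentSpace 𝓘(ℝ, E) x)) {p : ℕ}
    (𝒢 : Set (GrassmannBundle E X p)) (u : X → EReal) : Prop where
  usc : IsUSC u
  trace_nonneg : ∀ (x : X) (φ : X → ℝ), IsTestFunction (E := E) u φ x →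
    ∀ c ∈ atlas E X, x ∈ c.source → ∀ W ∈ fibre 𝒢 x,
      0 ≤ traceOn (g.inner x) W (hessian c g.inner φ x)

/-! ### Submanifolds

A submanifold of `X` is given by a manifold `M` and an immersion `ι : M → X`. -/

variable {F : Type*} [NormedAddCommGroup F] [NormedSpace ℝ F]
  {M : Type*} [TopologicalSpace M] [ChartedSpace F M]

/-- `ι` is a smooth immersion whose tangent planes all belong to `𝒢`. -/
structure IsGSubmanifold {p : ℕ} (𝒢 : Set (GrassmannBundle E X p)) (ι : M → X) : Prop where
  contMDiff : ContMDiff 𝓘(ℝ, F) 𝓘(ℝ, E) ∞ ι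
  injective_mfderiv : ∀ m : M, Function.Injective (mfderiv 𝓘(ℝ, F) 𝓘(ℝ, E) ι m)
  tangent_mem : ∀ m : M, (mfderiv 𝓘(ℝ, F) 𝓘(ℝ, E) ι m).range ∈ fibre 𝒢 (ι m)

/-- The metric induced on `M` by the immersion `ι`. -/
def inducedMetric
    (g : Bundle.ContMDiffRiemannianMetric 𝓘(ℝ, E) ∞ E (fun x : X => TangentSpace 𝓘(ℝ, E) x))
    (ι : M → X) (m : M) :
    TangentSpace 𝓘(ℝ, F) m →L[ℝ] TangentSpace 𝓘(ℝ, F) m →L[ℝ] ℝ :=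
  pullback (g.inner (ι m)) (mfderiv 𝓘(ℝ, F) 𝓘(ℝ, E) ι m)

/-- The coordinate expression of the covariant derivatives `∇_{∂_v} ∂_w` along the immersion `ι`
(`∇` the Levi-Civita connection of `X`), in the charts `d` of `M` around `m` and `c` of `X`
around `ι m`: it is `D²f(v, w) + Γ(Df v, Df w)`, where `f = c ∘ ι ∘ d⁻¹`. -/
def coordSecondDeriv (c : OpenPartialHomeomorph X E) (d : OpenPartialHomeomorph M F)
    (g : Bundle.ContMDiffRiemannianMetric 𝓘(ℝ, E) ∞ E (fun x : X => TangentSpace 𝓘(ℝ, E) x))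
    (ι : M → X) (m : M) : F →L[ℝ] F →L[ℝ] E :=
  fderiv ℝ (fderiv ℝ (c ∘ ι ∘ d.symm)) (d m) +
    (christoffel (metricInChart c g.inner) (c (ι m))).bilinearComp
      (fderiv ℝ (c ∘ ι ∘ d.symm) (d m)) (fderiv ℝ (c ∘ ι ∘ d.symm) (d m))

/-- The second fundamental form of the immersion `ι` at `m` in the direction of the normal vector
`ξ`: `(v, w) ↦ ⟨∇_v w, ξ⟩`, computed in charts.  (For `ξ` normal it does not depend on the
charts.) -/
def secondFundamentalForm (c : OpenPartialHomeomorph X E) (d : OpenPartialHomeomorph M F)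
    (g : Bundle.ContMDiffRiemannianMetric 𝓘(ℝ, E) ∞ E (fun x : X => TangentSpace 𝓘(ℝ, E) x))
    (ι : M → X) (m : M) (ξ : TangentSpace 𝓘(ℝ, E) (ι m)) :
    TangentSpace 𝓘(ℝ, F) m →L[ℝ] TangentSpace 𝓘(ℝ, F) m →L[ℝ] ℝ :=
  let ξ' : E := mfderiv 𝓘(ℝ, E) 𝓘(ℝ, E) c (ι m) ξ
  let b : F →L[ℝ] F →L[ℝ] ℝ :=
    (ContinuousLinearMap.postcomp F (metricInChart c g.inner (c (ι m)) ξ')).comp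
      (coordSecondDeriv c d g ι m)
  pullback (V := F) b (mfderiv 𝓘(ℝ, F) 𝓘(ℝ, F) d m)

/-- The immersed submanifold is minimal: its mean curvature vector `H` vanishes, i.e.
`⟨H, ξ⟩ = tr ⟨II, ξ⟩ = 0` for all normal vectors `ξ`. -/
def IsMinimal
    (g : Bundle.ContMDiffRiemannianMetric 𝓘(ℝ, E) ∞ E (fun x : X => TangentSpace 𝓘(ℝ, E) x))
    (ι : M → X) : Prop :=
  ∀ m : M, ∀ c ∈ atlas E X, ι m ∈ c.source → ∀ d ∈ atlas F M, m ∈ d.source →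
    ∀ ξ : TangentSpace 𝓘(ℝ, E) (ι m),
      (∀ v : TangentSpace 𝓘(ℝ, F) m,
        g.inner (ι m) ξ (mfderiv 𝓘(ℝ, F) 𝓘(ℝ, E) ι m v) = 0) →
      traceWrt (inducedMetric (F := F) g ι m) (secondFundamentalForm c d g ι m ξ) = 0

end Manifold

end Pluri

end

/-!
Let `φ` be a test function for `u|_M` at `a`, which may be assumed to touch `u|_M` only at `a`.  In
coordinates around `a` let `r` be a left inverse of the immersion `f`.  The planes `range (df)` at
`r z` form a smooth plane field around `f a` which is tangent to `M` along `M`, and the retraction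
moves it into `𝒢` without changing it along `M`.  Let `P z` be the orthogonal projection onto the
resulting plane at `z` and put `L Ψ = tr_P Hess Ψ`.

The extension `Φ = φ ∘ r` need not be a test function for `u`, but adding `t q + const`, where
`q` is half the squared Euclidean length of `z - f (r z)`, gives test functions for `u` at points
`z_t` with `z_t → f a` and `t q(z_t) → 0` as `t → ∞`, and there `L Φ + t L q ≥ 0` since `u` is
`𝒢`-plurisubharmonic.  As `M` is minimal, `L` restricts along `M` to the Laplace-Beltrami operator,
so `L` annihilates along `M` the components of `z - f (r z)`, which vanish on `M`.  Hence
`L q = O(q)`, the error `t L q` tends to `0`, and `0 ≤ L Φ (f a) = (Δφ)(a)`.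
-/

noncomputable section

namespace Pluri

/-! ### Orthogonal projections and traces -/

section LinearAlgebra

variable {V W : Type*}
  [AddCommGroup V] [Module ℝ V] [TopologicalSpace V]
  [AddCommGroup W] [Module ℝ W] [TopologicalSpace W]

/-- A positive definite bilinear form.  Symmetry is not part of the definition. -/
def PosDef (b : V →L[ℝ] V →L[ℝ] ℝ) : Prop := ∀ v, v ≠ 0 → 0 < b v v

variable {b : V →L[ℝ] V →L[ℝ] ℝ}

theorem PosDef.pullback_of_injective (hb : PosDef b) {L : W →L[ℝ] V}
    (hL : Function.Injective L) : PosDef (pullback b L) :=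
  fun _ hw => hb _ <| (map_ne_zero_iff L hL).2 hw

theorem PosDef.eq_of_forall_apply_eq (hb : PosDef b) {S : Submodule ℝ V} {v w : V} (hv : v ∈ S)
    (hw : w ∈ S) (h : ∀ s ∈ S, b v s = b w s) : v = w := by
  by_contra hne
  have hpos := hb (v - w) (sub_ne_zero.2 hne)
  rw [map_sub b, sub_apply, h _ (S.sub_mem hv hw), sub_self] at hpos
  exact lt_irrefl _ hpos

theorem orthProj_mem (b : V →L[ℝ] V →L[ℝ] ℝ) (S : Submodule ℝ V) (v : V) : orthProj b S v ∈ S :=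
  Subtype.coe_prop _

variable [IsTopologicalAddGroup V]

theorem traceWrt_sub (b A B : V →L[ℝ] V →L[ℝ] ℝ) :
    traceWrt b (A - B) = traceWrt b A - traceWrt b B := by
  rw [traceWrt, ContinuousLinearMap.comp_sub]
  exact map_sub _ _ _

variable [ContinuousSMul ℝ V] [T2Space V] [FiniteDimensional ℝ V]

theorem PosDef.isInvertible (hb : PosDef b) : b.IsInvertible := by
  have hinj : Function.Injective (b : V →ₗ[ℝ] V →L[ℝ] ℝ) := by
    refine (injective_iff_map_eq_zero _).2 fun v hv => by_contra fun hne => (hb v hne).ne' ?_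
    exact congrArg (fun l : V →L[ℝ] ℝ => l v) hv
  have e : (V →ₗ[ℝ] ℝ) ≃ₗ[ℝ] (V →L[ℝ] ℝ) := LinearMap.toContinuousLinearMap
  have : FiniteDimensional ℝ (V →L[ℝ] ℝ) := e.finiteDimensional
  have hdim : Module.finrank ℝ V = Module.finrank ℝ (V →L[ℝ] ℝ) :=
    Subspace.dual_finrank_eq.symm.trans e.finrank_eq
  exact ⟨(LinearEquiv.ofInjectiveOfFinrankEq _ hinj hdim).toContinuousLinearEquiv, rfl⟩

theorem PosDef.apply_inverse (hb : PosDef b) (l : V →L[ℝ] ℝ) : b (b.inverse l) = l :=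
  hb.isInvertible.self_apply_inverse l

theorem PosDef.apply_orthProj (hb : PosDef b) {S : Submodule ℝ V} (v : V) {s : V} (hs : s ∈ S) :
    b (orthProj b S v) s = b v s :=
  congrArg (fun l : S →L[ℝ] ℝ => l ⟨s, hs⟩) <|
    (hb.pullback_of_injective (L := S.subtypeL) Subtype.val_injective).apply_inverse
      (ContinuousLinearMap.precomp ℝ S.subtypeL (b v))

theorem PosDef.orthProj_eq_of_forall_apply_eq (hb : PosDef b) {S : Submodule ℝ V} {v w : V}
    (hw : w ∈ S) (h : ∀ s ∈ S, b w s = b v s) : orthProj b S v = w :=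
  hb.eq_of_forall_apply_eq (orthProj_mem b S v) hw fun s hs => by
    rw [hb.apply_orthProj v hs, h s hs]

theorem PosDef.orthProj_eq_self (hb : PosDef b) {S : Submodule ℝ V} {v : V} (hv : v ∈ S) :
    orthProj b S v = v :=
  hb.orthProj_eq_of_forall_apply_eq hv fun _ _ => rfl

theorem PosDef.orthProj_top (hb : PosDef b) : orthProj b ⊤ = ContinuousLinearMap.id ℝ V :=
  ContinuousLinearMap.ext fun _ => hb.orthProj_eq_self trivial

theorem PosDef.orthProj_inverse_comp_orthProj (hb : PosDef b) (S : Submodule ℝ V)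
    (α : V →L[ℝ] ℝ) :
    orthProj b S (b.inverse (α.comp (orthProj b S))) = orthProj b S (b.inverse α) := by
  refine hb.orthProj_eq_of_forall_apply_eq (orthProj_mem _ _ _) fun s hs => ?_
  rw [hb.apply_orthProj _ hs, hb.apply_inverse, hb.apply_inverse,
    ContinuousLinearMap.comp_apply, hb.orthProj_eq_self hs]

theorem PosDef.trace_orthProj_smulRight (hb : PosDef b) (S : Submodule ℝ V) (α : V →L[ℝ] ℝ) :
    LinearMap.trace ℝ V ((orthProj b S).comp (b.inverse.comp (α.smulRight α)) : V →L[ℝ] V) =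
      α.comp (orthProj b S) (b.inverse (α.comp (orthProj b S))) := by
  have hrank : (((orthProj b S).comp (b.inverse.comp (α.smulRight α)) : V →L[ℝ] V) : V →ₗ[ℝ] V) =
      (α : V →ₗ[ℝ] ℝ).smulRight (orthProj b S (b.inverse α)) := by
    ext v
    simp
  rw [hrank, LinearMap.trace_smulRight, ContinuousLinearMap.comp_apply,
    hb.orthProj_inverse_comp_orthProj]
  rfl

variable [IsTopologicalAddGroup W] [ContinuousSMul ℝ W] [T2Space W] [FiniteDimensional ℝ W]

theorem PosDef.orthProj_map (hb : PosDef b) {L : W →L[ℝ] V} (hL : Function.Injective L)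
    (S : Submodule ℝ W) (w : W) :
    orthProj b (S.map (L : W →ₗ[ℝ] V)) (L w) = L (orthProj (pullback b L) S w) := by
  refine hb.orthProj_eq_of_forall_apply_eq ⟨_, orthProj_mem _ _ _, rfl⟩ ?_
  rintro _ ⟨s, hs, rfl⟩
  exact (hb.pullback_of_injective hL).apply_orthProj w hs

-- These are the normal equations.
theorem PosDef.orthProj_range (hb : PosDef b) {L : W →L[ℝ] V} (hL : Function.Injective L) :
    orthProj b L.range =
      L.comp ((pullback b L).inverse.comp ((ContinuousLinearMap.precomp ℝ L).comp b)) := by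
  ext v
  refine hb.orthProj_eq_of_forall_apply_eq ⟨_, rfl⟩ ?_
  rintro _ ⟨w, rfl⟩
  exact congrArg (fun l : W →L[ℝ] ℝ => l w) <|
    (hb.pullback_of_injective hL).apply_inverse (ContinuousLinearMap.precomp ℝ L (b v))

theorem PosDef.traceWrt_pullback (hb : PosDef b) {L : W →L[ℝ] V} (hL : Function.Injective L)
    (A : V →L[ℝ] V →L[ℝ] ℝ) :
    traceWrt (pullback b L) (pullback A L) =
      LinearMap.trace ℝ V ((orthProj b L.range).comp (b.inverse.comp A) : V →L[ℝ] V) := by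
  set T : V →L[ℝ] W :=
    ((pullback b L).inverse.comp ((ContinuousLinearMap.precomp ℝ L).comp b)).comp
      (b.inverse.comp A) with hT
  have hLT : (orthProj b L.range).comp (b.inverse.comp A) = L.comp T := by
    rw [hb.orthProj_range hL]
    rfl
  have hTL : (pullback b L).inverse.comp (pullback A L) = T.comp L := by
    ext w
    simp only [hT, ContinuousLinearMap.comp_apply, hb.apply_inverse]
    rfl
  rw [hLT, traceWrt, hTL]
  exact LinearMap.trace_comp_comm' (L : W →ₗ[ℝ] V) (T : V →ₗ[ℝ] W)

theorem PosDef.traceOn_eq_trace (hb : PosDef b) (S : Submodule ℝ V) (A : V →L[ℝ] V →L[ℝ] ℝ) :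
    traceOn b S A =
      LinearMap.trace ℝ V ((orthProj b S).comp (b.inverse.comp A) : V →L[ℝ] V) := by
  have hrange : S.subtypeL.range = S := S.range_subtype
  rw [traceOn, hb.traceWrt_pullback (L := S.subtypeL) Subtype.val_injective, hrange]

theorem PosDef.traceWrt_pullback_equiv (hb : PosDef b) (L : W ≃L[ℝ] V)
    (A : V →L[ℝ] V →L[ℝ] ℝ) :
    traceWrt (pullback b (L : W →L[ℝ] V)) (pullback A (L : W →L[ℝ] V)) = traceWrt b A := by
  have hrange : (L : W →L[ℝ] V).range = ⊤ := LinearMap.range_eq_top.2 L.surjective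
  rw [hb.traceWrt_pullback L.injective, hrange, hb.orthProj_top]
  rfl

theorem PosDef.traceWrt_pullback_eq_traceOn (hb : PosDef b) {L : W →L[ℝ] V}
    (hL : Function.Injective L) (A : V →L[ℝ] V →L[ℝ] ℝ) :
    traceWrt (pullback b L) (pullback A L) = traceOn b L.range A := by
  rw [hb.traceWrt_pullback hL, hb.traceOn_eq_trace]

theorem PosDef.traceOn_pullback (hb : PosDef b) {L : W →L[ℝ] V} (hL : Function.Injective L)
    (S : Submodule ℝ W) (A : V →L[ℝ] V →L[ℝ] ℝ) :
    traceOn (pullback b L) S (pullback A L) = traceOn b (S.map (L : W →ₗ[ℝ] V)) A := by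
  have hrange : (L.comp S.subtypeL).range = S.map (L : W →ₗ[ℝ] V) := by
    ext
    simp
  rw [← hrange]
  exact hb.traceWrt_pullback_eq_traceOn (L := L.comp S.subtypeL)
    (hL.comp Subtype.val_injective) A

end LinearAlgebra

/-! ### Hessians in coordinates -/

section Calculus

variable {D E F : Type*} [NormedAddCommGroup D] [NormedSpace ℝ D]
  [NormedAddCommGroup E] [NormedSpace ℝ E] [NormedAddCommGroup F] [NormedSpace ℝ F]
  {k m n : WithTop ℕ∞}

theorem eventually_differentiableAt {f : E → F} {x : E} (hf : ContDiffAt ℝ 2 f x) :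
    ∀ᶠ y in 𝓝 x, DifferentiableAt ℝ f y :=
  (hf.eventually (by simp)).mono fun _ h => h.differentiableAt two_ne_zero

theorem differentiableAt_fderiv {f : E → F} {x : E} (hf : ContDiffAt ℝ 2 f x) :
    DifferentiableAt ℝ (fderiv ℝ f) x :=
  (hf.fderiv_right (m := 1) one_add_one_eq_two.le).differentiableAt one_ne_zero

theorem contDiffAt_inverse [CompleteSpace E] {A : D → E →L[ℝ] F} {x : D}
    (hA : ContDiffAt ℝ n A x) (hx : (A x).IsInvertible) :
    ContDiffAt ℝ n (fun y => (A y).inverse) x :=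
  hx.contDiffAt_map_inverse.comp x hA

theorem contDiffAt_pullback {A : D → E →L[ℝ] E →L[ℝ] ℝ} {L : D → F →L[ℝ] E} {x : D}
    (hA : ContDiffAt ℝ n A x) (hL : ContDiffAt ℝ n L x) :
    ContDiffAt ℝ n (fun y => pullback (A y) (L y)) x :=
  ((ContinuousLinearMap.compL ℝ F E ℝ).flip.contDiff.contDiffAt.comp x hL).clm_comp
    (hA.clm_comp hL)

theorem contDiffAt_trace [FiniteDimensional ℝ E] {A : D → E →L[ℝ] E} {x : D}
    (hA : ContDiffAt ℝ n A x) : ContDiffAt ℝ n (fun y => LinearMap.trace ℝ E (A y)) x :=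
  (LinearMap.toContinuousLinearMap
    (LinearMap.trace ℝ E ∘ₗ ContinuousLinearMap.coeLM ℝ)).contDiff.contDiffAt.comp x hA

theorem fderiv_fderiv_comp {f : F → E} {Φ : E → ℝ} {x : F} (hΦ : ContDiffAt ℝ 2 Φ (f x))
    (hf : ContDiffAt ℝ 2 f x) (v w : F) :
    fderiv ℝ (fderiv ℝ (Φ ∘ f)) x v w =
      fderiv ℝ (fderiv ℝ Φ) (f x) (fderiv ℝ f x v) (fderiv ℝ f x w) +
        fderiv ℝ Φ (f x) (fderiv ℝ (fderiv ℝ f) x v w) := by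
  have hchain : fderiv ℝ (Φ ∘ f) =ᶠ[𝓝 x] fun y => (fderiv ℝ Φ (f y)).comp (fderiv ℝ f y) := by
    filter_upwards [eventually_differentiableAt hf,
      hf.continuousAt.eventually (eventually_differentiableAt hΦ)] with y hfy hΦy
    exact fderiv_comp y hΦy hfy
  have hprod := ((differentiableAt_fderiv hΦ).hasFDerivAt.comp x
    (hf.differentiableAt two_ne_zero).hasFDerivAt).clm_comp (differentiableAt_fderiv hf).hasFDerivAt
  rw [hchain.fderiv_eq]
  refine (DFunLike.congr_fun (DFunLike.congr_fun hprod.fderiv v) w).trans ?_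
  simp [add_comm]

variable {G : E → E →L[ℝ] E →L[ℝ] ℝ} {φ ψ : E → ℝ} {z : E}

theorem contDiffAt_koszul (hG : ContDiffAt ℝ n G z) (hmn : m + 1 ≤ n) :
    ContDiffAt ℝ m (koszul G) z := by
  have hD : ContDiffAt ℝ m (fderiv ℝ G) z := hG.fderiv_right hmn
  have hflip : ContDiffAt ℝ m (fun y => (fderiv ℝ G y).flip) z :=
    (ContinuousLinearMap.flipₗᵢ ℝ E E (E →L[ℝ] ℝ)).toContinuousLinearEquiv.contDiff.contDiffAt.comp
      z hD
  exact ((hD.add hflip).sub (contDiffAt_const.clm_comp hflip)).const_smul (1 / 2 : ℝ)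

theorem contDiffAt_christoffel [CompleteSpace E] (hG : ContDiffAt ℝ n G z) (hmn : m + 1 ≤ n)
    (hinv : (G z).IsInvertible) : ContDiffAt ℝ m (christoffel G) z := by
  have hGinv : ContDiffAt ℝ m (fun y => (G y).inverse) z :=
    contDiffAt_inverse (hG.of_le (le_self_add.trans hmn)) hinv
  exact ((ContinuousLinearMap.compL ℝ E (E →L[ℝ] ℝ) E).contDiff.contDiffAt.comp z hGinv).clm_comp
    (contDiffAt_koszul hG hmn)

theorem contDiffAt_coordHessian [CompleteSpace E] (hG : ContDiffAt ℝ n G z) (hmn : m + 1 ≤ n)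
    (hinv : (G z).IsInvertible) (hφ : ContDiffAt ℝ k φ z) (hmk : m + 1 + 1 ≤ k) :
    ContDiffAt ℝ m (coordHessian G φ) z := by
  have hdφ : ContDiffAt ℝ (m + 1) (fderiv ℝ φ) z := hφ.fderiv_right hmk
  exact (hdφ.fderiv_right le_rfl).sub
    (((ContinuousLinearMap.compL ℝ E E ℝ).contDiff.contDiffAt.comp z
      (hdφ.of_le le_self_add)).clm_comp (contDiffAt_christoffel hG hmn hinv))

theorem coordHessian_congr {G' : E → E →L[ℝ] E →L[ℝ] ℝ} (hG : G =ᶠ[𝓝 z] G')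
    (h : φ =ᶠ[𝓝 z] ψ) : coordHessian G φ z = coordHessian G' ψ z := by
  rw [coordHessian, coordHessian, christoffel, christoffel, koszul, koszul, hG.fderiv_eq,
    hG.eq_of_nhds, h.fderiv.fderiv_eq, h.fderiv_eq]

theorem coordHessian_zero (G : E → E →L[ℝ] E →L[ℝ] ℝ) (z : E) :
    coordHessian G (fun _ => 0) z = 0 := by
  ext v w
  simp [coordHessian_apply, fderiv_fun_const]

theorem coordHessian_add_const_mul_add_const (G : E → E →L[ℝ] E →L[ℝ] ℝ)
    (hφ : ContDiffAt ℝ 2 φ z) (hψ : ContDiffAt ℝ 2 ψ z) (t s : ℝ) :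
    coordHessian G (fun y => φ y + t * ψ y + s) z =
      coordHessian G φ z + t • coordHessian G ψ z := by
  have hd : fderiv ℝ (fun y => φ y + t * ψ y + s) =ᶠ[𝓝 z]
      fun y => fderiv ℝ φ y + t • fderiv ℝ ψ y := by
    filter_upwards [eventually_differentiableAt hφ, eventually_differentiableAt hψ] with y h₁ h₂
    rw [fderiv_add_const, fderiv_fun_add h₁ (h₂.const_mul t), fderiv_const_mul h₂]
  have hdd : fderiv ℝ (fun y => fderiv ℝ φ y + t • fderiv ℝ ψ y) z =
      fderiv ℝ (fderiv ℝ φ) z + t • fderiv ℝ (fderiv ℝ ψ) z :=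
    ((differentiableAt_fderiv hφ).hasFDerivAt.add
      ((differentiableAt_fderiv hψ).hasFDerivAt.const_smul t)).fderiv
  ext v w
  simp only [coordHessian_apply, hd.eq_of_nhds, hd.fderiv_eq, hdd, add_apply, smul_apply,
    smul_eq_mul]
  ring

theorem coordHessian_finset_sum {ι : Type*} (G : E → E →L[ℝ] E →L[ℝ] ℝ) (s : Finset ι)
    {φ : ι → E → ℝ} (hφ : ∀ i ∈ s, ContDiffAt ℝ 2 (φ i) z) :
    coordHessian G (fun y => ∑ i ∈ s, φ i y) z = ∑ i ∈ s, coordHessian G (φ i) z := by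
  have hd : fderiv ℝ (fun y => ∑ i ∈ s, φ i y) =ᶠ[𝓝 z] fun y => ∑ i ∈ s, fderiv ℝ (φ i) y := by
    filter_upwards [(Filter.eventually_all_finset s).2
      fun i hi => eventually_differentiableAt (hφ i hi)] with y hy
    rw [fderiv_fun_sum hy]
  ext v w
  simp only [coordHessian_apply, hd.eq_of_nhds, hd.fderiv_eq,
    fderiv_fun_sum fun i hi => differentiableAt_fderiv (hφ i hi), sum_apply,
    Finset.sum_sub_distrib]

theorem fderiv_half_sq (hφ : DifferentiableAt ℝ φ z) :
    fderiv ℝ (fun y => φ y ^ 2 / 2) z = φ z • fderiv ℝ φ z := by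
  simp only [div_eq_mul_inv]
  rw [((hφ.hasFDerivAt.pow 2).mul_const (2⁻¹ : ℝ)).fderiv]
  ext v
  simp [← mul_assoc]

theorem coordHessian_half_sq (G : E → E →L[ℝ] E →L[ℝ] ℝ) (hφ : ContDiffAt ℝ 2 φ z) :
    coordHessian G (fun y => φ y ^ 2 / 2) z =
      (fderiv ℝ φ z).smulRight (fderiv ℝ φ z) + φ z • coordHessian G φ z := by
  have hd : fderiv ℝ (fun y => φ y ^ 2 / 2) =ᶠ[𝓝 z] fun y => φ y • fderiv ℝ φ y :=
    (eventually_differentiableAt hφ).mono fun y => fderiv_half_sq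
  have hdd := ((hφ.differentiableAt two_ne_zero).hasFDerivAt.smul
    (differentiableAt_fderiv hφ).hasFDerivAt).fderiv
  ext v w
  rw [coordHessian_apply, hd.eq_of_nhds, hd.fderiv_eq]
  refine (congrArg (· - _) (DFunLike.congr_fun (DFunLike.congr_fun hdd v) w)).trans ?_
  simp only [add_apply, smul_apply, smul_eq_mul, ContinuousLinearMap.smulRight_apply,
    coordHessian_apply]
  ring

end Calculus

/-! ### The Gauss formula and minimality -/

section Gauss

variable {E F : Type*} [NormedAddCommGroup E] [NormedSpace ℝ E]
  [NormedAddCommGroup F] [NormedSpace ℝ F]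
  {G : E → E →L[ℝ] E →L[ℝ] ℝ} {f : F → E} {x : F}

/-- The metric induced by `G` on the domain of the immersion `f`. -/
def pullbackMetric (G : E → E →L[ℝ] E →L[ℝ] ℝ) (f : F → E) (x : F) : F →L[ℝ] F →L[ℝ] ℝ :=
  pullback (G (f x)) (fderiv ℝ f x)

/-- The covariant derivatives `∇_v (df w)` of the coordinate vector fields along `f`, where `∇` is
the Levi-Civita connection of `G`: the tangential part is the connection of the induced metric and
the normal part is the second fundamental form. -/
def covariantSecondDeriv (G : E → E →L[ℝ] E →L[ℝ] ℝ) (f : F → E) (x : F) : F →L[ℝ] F →L[ℝ] E :=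
  fderiv ℝ (fderiv ℝ f) x +
    (christoffel G (f x)).bilinearComp (fderiv ℝ f x) (fderiv ℝ f x)

/-- The mean curvature vector of `f` at `x` vanishes, tested against the normal vectors `ξ`. -/
def IsMinimalAt (G : E → E →L[ℝ] E →L[ℝ] ℝ) (f : F → E) (x : F) : Prop :=
  ∀ ξ : E, (∀ v, G (f x) ξ (fderiv ℝ f x v) = 0) →
    traceWrt (pullbackMetric G f x)
      ((ContinuousLinearMap.postcomp F (G (f x) ξ)).comp (covariantSecondDeriv G f x)) = 0

theorem fderiv_pullbackMetric (hG : DifferentiableAt ℝ G (f x)) (hf : ContDiffAt ℝ 2 f x)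
    (u v w : F) :
    fderiv ℝ (pullbackMetric G f) x u v w =
      fderiv ℝ G (f x) (fderiv ℝ f x u) (fderiv ℝ f x v) (fderiv ℝ f x w) +
        G (f x) (fderiv ℝ (fderiv ℝ f) x u v) (fderiv ℝ f x w) +
        G (f x) (fderiv ℝ f x v) (fderiv ℝ (fderiv ℝ f) x u w) := by
  have hGf := hG.hasFDerivAt.comp x (hf.differentiableAt two_ne_zero).hasFDerivAt
  have hdf := (differentiableAt_fderiv hf).hasFDerivAt
  have hprod := ((ContinuousLinearMap.compL ℝ F E ℝ).flip.hasFDerivAt.comp x hdf).clm_comp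
    (hGf.clm_comp hdf)
  rw [show fderiv ℝ (pullbackMetric G f) x = _ from hprod.fderiv]
  simp
  ring

theorem koszul_pullbackMetric (hG : DifferentiableAt ℝ G (f x))
    (hsymm : ∀ v w, G (f x) v w = G (f x) w v) (hf : ContDiffAt ℝ 2 f x) (v w u : F) :
    koszul (pullbackMetric G f) x v w u =
      koszul G (f x) (fderiv ℝ f x v) (fderiv ℝ f x w) (fderiv ℝ f x u) +
        G (f x) (fderiv ℝ (fderiv ℝ f) x v w) (fderiv ℝ f x u) := by
  have hs : IsSymmSndFDerivAt ℝ f x := hf.isSymmSndFDerivAt (by simp)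
  simp only [koszul_apply, fderiv_pullbackMetric hG hf]
  rw [hs.eq w v, hs.eq u v, hs.eq u w, hsymm (fderiv ℝ f x w) (fderiv ℝ (fderiv ℝ f) x v u)]
  ring

variable [FiniteDimensional ℝ E] [FiniteDimensional ℝ F]

theorem orthProj_covariantSecondDeriv (hG : DifferentiableAt ℝ G (f x)) (hpos : PosDef (G (f x)))
    (hsymm : ∀ v w, G (f x) v w = G (f x) w v) (hf : ContDiffAt ℝ 2 f x)
    (hinj : Function.Injective (fderiv ℝ f x)) (v w : F) :
    orthProj (G (f x)) (fderiv ℝ f x).range (covariantSecondDeriv G f x v w) =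
      fderiv ℝ f x (christoffel (pullbackMetric G f) x v w) := by
  refine hpos.orthProj_eq_of_forall_apply_eq ⟨_, rfl⟩ ?_
  rintro _ ⟨u, rfl⟩
  calc G (f x) (fderiv ℝ f x (christoffel (pullbackMetric G f) x v w)) (fderiv ℝ f x u)
      = koszul (pullbackMetric G f) x v w u :=
        congrArg (fun l : F →L[ℝ] ℝ => l u)
          ((hpos.pullback_of_injective hinj).apply_inverse (koszul (pullbackMetric G f) x v w))
    _ = G (f x) (fderiv ℝ (fderiv ℝ f) x v w) (fderiv ℝ f x u) +
          koszul G (f x) (fderiv ℝ f x v) (fderiv ℝ f x w) (fderiv ℝ f x u) := by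
        rw [koszul_pullbackMetric hG hsymm hf, add_comm]
    _ = G (f x) (covariantSecondDeriv G f x v w) (fderiv ℝ f x u) := by
        rw [← hpos.apply_inverse (koszul G (f x) (fderiv ℝ f x v) (fderiv ℝ f x w)), ← add_apply,
          ← map_add]
        rfl

theorem pullback_coordHessian_sub (hG : DifferentiableAt ℝ G (f x)) (hpos : PosDef (G (f x)))
    (hsymm : ∀ v w, G (f x) v w = G (f x) w v) (hf : ContDiffAt ℝ 2 f x)
    (hinj : Function.Injective (fderiv ℝ f x)) {Φ : E → ℝ} (hΦ : ContDiffAt ℝ 2 Φ (f x)) :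
    coordHessian (pullbackMetric G f) (Φ ∘ f) x -
        pullback (coordHessian G Φ (f x)) (fderiv ℝ f x) =
      (ContinuousLinearMap.postcomp F (fderiv ℝ Φ (f x) -
        (fderiv ℝ Φ (f x)).comp (orthProj (G (f x)) (fderiv ℝ f x).range))).comp
          (covariantSecondDeriv G f x) := by
  have hchain : fderiv ℝ (Φ ∘ f) x = (fderiv ℝ Φ (f x)).comp (fderiv ℝ f x) :=
    fderiv_comp x (hΦ.differentiableAt two_ne_zero) (hf.differentiableAt two_ne_zero)
  ext v w
  change coordHessian (pullbackMetric G f) (Φ ∘ f) x v w -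
      coordHessian G Φ (f x) (fderiv ℝ f x v) (fderiv ℝ f x w) =
    fderiv ℝ Φ (f x) (fderiv ℝ (fderiv ℝ f) x v w +
        christoffel G (f x) (fderiv ℝ f x v) (fderiv ℝ f x w)) -
      fderiv ℝ Φ (f x) (orthProj (G (f x)) (fderiv ℝ f x).range (covariantSecondDeriv G f x v w))
  rw [orthProj_covariantSecondDeriv hG hpos hsymm hf hinj, coordHessian_apply, coordHessian_apply,
    fderiv_fderiv_comp hΦ hf, hchain, ContinuousLinearMap.comp_apply, map_add]
  ring

theorem IsMinimalAt.traceOn_coordHessian (hmin : IsMinimalAt G f x)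
    (hG : DifferentiableAt ℝ G (f x)) (hpos : PosDef (G (f x)))
    (hsymm : ∀ v w, G (f x) v w = G (f x) w v) (hf : ContDiffAt ℝ 2 f x)
    (hinj : Function.Injective (fderiv ℝ f x)) {Φ : E → ℝ} (hΦ : ContDiffAt ℝ 2 Φ (f x)) :
    traceOn (G (f x)) (fderiv ℝ f x).range (coordHessian G Φ (f x)) =
      traceWrt (pullbackMetric G f x) (coordHessian (pullbackMetric G f) (Φ ∘ f) x) := by
  set ν : E →L[ℝ] ℝ := fderiv ℝ Φ (f x) -
    (fderiv ℝ Φ (f x)).comp (orthProj (G (f x)) (fderiv ℝ f x).range) with hν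
  have htangent (v : F) : orthProj (G (f x)) (fderiv ℝ f x).range (fderiv ℝ f x v) =
      fderiv ℝ f x v := hpos.orthProj_eq_self ⟨v, rfl⟩
  have hnormal := hmin ((G (f x)).inverse ν) fun v => by
    rw [hpos.apply_inverse, hν, sub_apply, ContinuousLinearMap.comp_apply, htangent, sub_self]
  rw [hpos.apply_inverse, ← pullback_coordHessian_sub hG hpos hsymm hf hinj hΦ, traceWrt_sub,
    sub_eq_zero] at hnormal
  rw [hnormal, ← hpos.traceWrt_pullback_eq_traceOn hinj]
  rfl

end Gauss

/-! ### Traces of the Hessian over a field of planes -/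

section PlaneLaplacian

variable {E : Type*} [NormedAddCommGroup E] [NormedSpace ℝ E]
  {G : E → E →L[ℝ] E →L[ℝ] ℝ} {P : E → E →L[ℝ] E} {Φ Ψ : E → ℝ} {z : E}

/-- The linear operator `Φ ↦ tr_P Hess Φ`.  When `P z` is the orthogonal projection onto a plane,
its value at `z` is the trace of the Hessian over that plane. -/
def planeLaplacian (G : E → E →L[ℝ] E →L[ℝ] ℝ) (P : E → E →L[ℝ] E) (Φ : E → ℝ) (z : E) : ℝ :=
  LinearMap.trace ℝ E ((P z).comp ((G z).inverse.comp (coordHessian G Φ z)) : E →L[ℝ] E)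

theorem planeLaplacian_add_const_mul_add_const (hΦ : ContDiffAt ℝ 2 Φ z)
    (hΨ : ContDiffAt ℝ 2 Ψ z) (t s : ℝ) :
    planeLaplacian G P (fun y => Φ y + t * Ψ y + s) z =
      planeLaplacian G P Φ z + t * planeLaplacian G P Ψ z := by
  simp only [planeLaplacian, coordHessian_add_const_mul_add_const G hΦ hΨ,
    ContinuousLinearMap.comp_add, ContinuousLinearMap.comp_smul,
    ContinuousLinearMap.toLinearMap_add, ContinuousLinearMap.toLinearMap_smul, map_add, map_smul,
    smul_eq_mul]

theorem planeLaplacian_finset_sum {ι : Type*} (s : Finset ι) {Φ : ι → E → ℝ}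
    (hΦ : ∀ i ∈ s, ContDiffAt ℝ 2 (Φ i) z) :
    planeLaplacian G P (fun y => ∑ i ∈ s, Φ i y) z = ∑ i ∈ s, planeLaplacian G P (Φ i) z := by
  simp only [planeLaplacian, coordHessian_finset_sum G s hΦ, ContinuousLinearMap.comp_finsetSum,
    ContinuousLinearMap.toLinearMap_sum, map_sum]

variable [FiniteDimensional ℝ E]

theorem planeLaplacian_eq_traceOn (hpos : PosDef (G z)) {S : Submodule ℝ E}
    (hP : P z = orthProj (G z) S) :
    planeLaplacian G P Φ z = traceOn (G z) S (coordHessian G Φ z) := by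
  rw [planeLaplacian, hP, hpos.traceOn_eq_trace]

theorem planeLaplacian_half_sq (hpos : PosDef (G z)) {S : Submodule ℝ E}
    (hP : P z = orthProj (G z) S) (hΦ : ContDiffAt ℝ 2 Φ z) :
    planeLaplacian G P (fun y => Φ y ^ 2 / 2) z =
      (fderiv ℝ Φ z).comp (P z) ((G z).inverse ((fderiv ℝ Φ z).comp (P z))) +
        Φ z * planeLaplacian G P Φ z := by
  rw [planeLaplacian, planeLaplacian, coordHessian_half_sq G hΦ, ContinuousLinearMap.comp_add,
    ContinuousLinearMap.comp_add, ContinuousLinearMap.toLinearMap_add, map_add, hP,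
    hpos.trace_orthProj_smulRight, ContinuousLinearMap.comp_smul, ContinuousLinearMap.comp_smul,
    ContinuousLinearMap.toLinearMap_smul, map_smul, smul_eq_mul]

theorem contDiffAt_planeLaplacian {k m n : WithTop ℕ∞} (hG : ContDiffAt ℝ n G z) (hmn : m + 1 ≤ n)
    (hpos : PosDef (G z)) (hP : ContDiffAt ℝ m P z) (hΦ : ContDiffAt ℝ k Φ z)
    (hmk : m + 1 + 1 ≤ k) : ContDiffAt ℝ m (planeLaplacian G P Φ) z :=
  contDiffAt_trace <| hP.clm_comp <|
    (contDiffAt_inverse (hG.of_le (le_self_add.trans hmn)) hpos.isInvertible).clm_comp <|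
      contDiffAt_coordHessian hG hmn hpos.isInvertible hΦ hmk

end PlaneLaplacian

/-! ### Penalized test functions -/

section Penalization

variable {Z : Type*} [TopologicalSpace Z] {K : Set Z} {u : Z → EReal} {φ ψ q : Z → ℝ} {z z₀ : Z}

theorem eventually_lt_coe_of_upperSemicontinuousWithinAt (hu : UpperSemicontinuousWithinAt u K z)
    (hψ : ContinuousWithinAt ψ K z) (h : u z < ψ z) : ∀ᶠ w in 𝓝[K] z, u w < ψ w := by
  obtain ⟨r, hr, hrψ⟩ := EReal.lt_iff_exists_real_btwn.1 h
  filter_upwards [hu _ hr, hψ.eventually_const_lt (EReal.coe_lt_coe_iff.1 hrψ)] with w h₁ h₂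
  exact h₁.trans (EReal.coe_lt_coe_iff.2 h₂)

theorem exists_touching_translate (hK : IsCompact K) (hu : UpperSemicontinuousOn u K)
    (htop : ∀ z ∈ K, u z ≠ ⊤) (hψ : ContinuousOn ψ K) (hz₀ : z₀ ∈ K) (h₀ : u z₀ = ψ z₀) :
    ∃ z ∈ K, ∃ s : ℝ, 0 ≤ s ∧ u z = (ψ z + s : ℝ) ∧ ∀ w ∈ K, u w ≤ (ψ w + s : ℝ) := by
  have husc : UpperSemicontinuousOn (fun z => u z - ψ z) K := by
    have hneg : ContinuousOn (fun z => -(ψ z : EReal)) K :=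
      (continuous_coe_real_ereal.comp_continuousOn hψ).neg
    exact hu.add' hneg.upperSemicontinuousOn fun z _ =>
      EReal.continuousAt_add (.inr (EReal.coe_ne_bot (-ψ z))) (.inr (EReal.coe_ne_top (-ψ z)))
  obtain ⟨z, hzK, hmax⟩ := UpperSemicontinuousOn.exists_isMaxOn ⟨z₀, hz₀⟩ hK husc
  have hnonneg : 0 ≤ u z - ψ z := by
    simpa only [h₀, ← EReal.coe_sub, sub_self, EReal.coe_zero] using mem_ofPred.1 (hmax hz₀)
  have hne_top : u z - ψ z ≠ ⊤ := by
    rw [sub_eq_add_neg]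
    exact EReal.add_ne_top (htop z hzK) (EReal.coe_ne_top (-ψ z))
  lift u z - ψ z to ℝ using ⟨hne_top, ne_bot_of_le_ne_bot EReal.zero_ne_bot hnonneg⟩ with s hs
  refine ⟨z, hzK, s, EReal.coe_nonneg.1 hnonneg, ?_, fun w hw => ?_⟩
  · rw [EReal.coe_add, hs, add_comm, EReal.sub_add_cancel]
  · rw [EReal.coe_add, hs, add_comm]
    exact (EReal.sub_le_iff_le_add (.inl (EReal.coe_ne_bot _)) (.inl (EReal.coe_ne_top _))).1
      (hmax hw)

theorem eventually_lt_coe_add_mul (hu : UpperSemicontinuousWithinAt u K z)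
    (htop : u z ≠ ⊤) (hφ : ContinuousWithinAt φ K z) (hq : ContinuousWithinAt q K z)
    (hqz : 0 ≤ q z) (hlt : q z = 0 → u z < φ z) :
    ∃ t : ℝ, ∀ᶠ w in 𝓝[K] z, u w < (φ w + t * q w : ℝ) := by
  obtain ⟨t, ht⟩ : ∃ t : ℝ, u z < (φ z + t * q z : ℝ) := by
    rcases hqz.eq_or_lt with hqz | hqz
    · exact ⟨0, by simpa using hlt hqz.symm⟩
    · obtain ⟨r, hr, -⟩ := EReal.lt_iff_exists_real_btwn.1 htop.lt_top
      refine ⟨(r - φ z) / q z, ?_⟩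
      rwa [div_mul_cancel₀ _ hqz.ne', add_sub_cancel]
  exact ⟨t, eventually_lt_coe_of_upperSemicontinuousWithinAt hu
    (hφ.add (continuousWithinAt_const.mul hq)) ht⟩

theorem eventually_penalized_localized (hK : IsCompact K) (hu : UpperSemicontinuousOn u K)
    (htop : ∀ z ∈ K, u z ≠ ⊤) (hφ : ContinuousOn φ K) (hq : ContinuousOn q K)
    (hqK : ∀ z ∈ K, 0 ≤ q z) (h₀ : u z₀ = φ z₀)
    (hlt : ∀ z ∈ K, q z = 0 → z ≠ z₀ → u z < φ z) {N : Set Z} (hN : N ∈ 𝓝 z₀) {η : ℝ}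
    (hη : 0 < η) :
    ∀ᶠ t : ℝ in atTop, ∀ z ∈ K, (φ z + t * q z : ℝ) ≤ u z → z ∈ N ∧ u z < (φ z + η : ℝ) := by
  refine hK.induction_on (p := fun T => ∀ᶠ t : ℝ in atTop, ∀ z ∈ T, (φ z + t * q z : ℝ) ≤ u z →
    z ∈ N ∧ u z < (φ z + η : ℝ)) (by simp)
    (fun S T hST hT => hT.mono fun t ht z hz => ht z (hST hz))
    (fun S T hS hT => (hS.and hT).mono fun t ht z hz => hz.elim (ht.1 z) (ht.2 z))
    fun z hz => ?_
  by_cases hzz : z = z₀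
  · subst hzz
    have hclose : ∀ᶠ w in 𝓝[K] z, u w < (φ w + η : ℝ) :=
      eventually_lt_coe_of_upperSemicontinuousWithinAt (hu z hz)
        ((hφ z hz).add continuousWithinAt_const)
        (by rw [h₀]; exact EReal.coe_lt_coe_iff.2 (lt_add_of_pos_right _ hη))
    exact ⟨_, inter_mem (mem_nhdsWithin_of_mem_nhds hN) hclose,
      Eventually.of_forall fun t w hw _ => hw⟩
  · obtain ⟨t₀, ht₀⟩ := eventually_lt_coe_add_mul (hu z hz) (htop z hz) (hφ z hz) (hq z hz)
      (hqK z hz) (fun hqz => hlt z hz hqz hzz)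
    refine ⟨_, inter_mem self_mem_nhdsWithin ht₀, ?_⟩
    filter_upwards [eventually_ge_atTop t₀] with t ht w ⟨hwK, hw⟩ hle
    refine absurd (hw.trans_le (EReal.coe_le_coe_iff.2 ?_)) hle.not_gt
    gcongr
    exact hqK w hwK

theorem exists_penalized_touching (hK : IsCompact K) (hu : UpperSemicontinuousOn u K)
    (htop : ∀ z ∈ K, u z ≠ ⊤) (hφ : ContinuousOn φ K) (hq : ContinuousOn q K)
    (hqK : ∀ z ∈ K, 0 ≤ q z) (hz₀ : z₀ ∈ K) (h₀ : u z₀ = φ z₀) (hq₀ : q z₀ = 0)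
    (hlt : ∀ z ∈ K, q z = 0 → z ≠ z₀ → u z < φ z) {N : Set Z} (hN : N ∈ 𝓝 z₀) {η : ℝ}
    (hη : 0 < η) :
    ∃ t : ℝ, 0 ≤ t ∧ ∃ z ∈ K ∩ N, t * q z < η ∧ ∃ s : ℝ,
      u z = (φ z + t * q z + s : ℝ) ∧ ∀ w ∈ K, u w ≤ (φ w + t * q w + s : ℝ) := by
  obtain ⟨t, hloc, ht⟩ :=
    ((eventually_penalized_localized hK hu htop hφ hq hqK h₀ hlt hN hη).and
      (eventually_ge_atTop 0)).exists
  obtain ⟨z, hzK, s, hs, hz, hle⟩ := exists_touching_translate (ψ := fun z => φ z + t * q z)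
    hK hu htop (hφ.add (continuousOn_const.mul hq)) hz₀ (by simp only [h₀, hq₀, mul_zero, add_zero])
  have ⟨hzN, hzη⟩ := hloc z hzK (by rw [hz]; exact EReal.coe_le_coe_iff.2 (by linarith))
  rw [hz, EReal.coe_lt_coe_iff] at hzη
  exact ⟨t, ht, z, ⟨hzK, hzN⟩, by linarith, s, hz, hle⟩

end Penalization

section PenalizedLaplacian

variable {E : Type*} [NormedAddCommGroup E] [NormedSpace ℝ E] [FiniteDimensional ℝ E]
  {G : E → E →L[ℝ] E →L[ℝ] ℝ} {P : E → E →L[ℝ] E} {u : E → EReal} {Φ q : E → ℝ} {z₀ : E}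

theorem exists_isTestFunction_penalized
    (husc : ∀ᶠ z in 𝓝 z₀, UpperSemicontinuousAt u z) (htop : ∀ᶠ z in 𝓝 z₀, u z ≠ ⊤)
    (hΦ : ContDiffAt ℝ 2 Φ z₀) (hq : ContDiffAt ℝ 2 q z₀) (hq_nonneg : ∀ z, 0 ≤ q z)
    (h₀ : u z₀ = Φ z₀) (hq₀ : q z₀ = 0) (hlt : ∀ᶠ z in 𝓝 z₀, q z = 0 → z ≠ z₀ → u z < Φ z)
    {N : Set E} (hN : N ∈ 𝓝 z₀) {η : ℝ} (hη : 0 < η) :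
    ∃ t : ℝ, 0 ≤ t ∧ ∃ z ∈ N, t * q z < η ∧ ContDiffAt ℝ 2 Φ z ∧ ContDiffAt ℝ 2 q z ∧
      ∃ s : ℝ, IsTestFunction (E := E) u (fun w => Φ w + t * q w + s) z := by
  obtain ⟨ε, hε, hK⟩ := Metric.nhds_basis_closedBall.eventually_iff.1
    (husc.and <| htop.and <| hlt.and <| (hΦ.eventually (by simp)).and (hq.eventually (by simp)))
  obtain ⟨t, ht, z, ⟨hzK, hzN, hzball⟩, htq, s, hz, hle⟩ := exists_penalized_touching
    (isCompact_closedBall z₀ ε) (fun z hz => (hK hz).1.upperSemicontinuousWithinAt _)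
    (fun z hz => (hK hz).2.1)
    (fun z hz => (hK hz).2.2.2.1.continuousAt.continuousWithinAt)
    (fun z hz => (hK hz).2.2.2.2.continuousAt.continuousWithinAt)
    (fun z _ => hq_nonneg z) (Metric.mem_closedBall_self hε.le) h₀ hq₀ (fun z hz => (hK hz).2.2.1)
    (inter_mem hN (Metric.ball_mem_nhds z₀ hε)) hη
  obtain ⟨-, -, -, hΦz, hqz⟩ := hK hzK
  refine ⟨t, ht, z, hzN, htq, hΦz, hqz, s, ?_, ?_, hz⟩
  · exact ((hΦz.add (contDiffAt_const.mul hqz)).add contDiffAt_const).contMDiffAt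
  · filter_upwards [Metric.isOpen_ball.mem_nhds hzball] with w hw
    exact hle w (Metric.ball_subset_closedBall hw)

theorem planeLaplacian_nonneg_of_penalty
    (hLΦ : ContinuousAt (planeLaplacian G P Φ) z₀) (hLq : planeLaplacian G P q =O[𝓝 z₀] q)
    (husc : ∀ᶠ z in 𝓝 z₀, UpperSemicontinuousAt u z) (htop : ∀ᶠ z in 𝓝 z₀, u z ≠ ⊤)
    (hΦ : ContDiffAt ℝ 2 Φ z₀) (hq : ContDiffAt ℝ 2 q z₀) (hq_nonneg : ∀ z, 0 ≤ q z)
    (h₀ : u z₀ = Φ z₀) (hq₀ : q z₀ = 0) (hlt : ∀ᶠ z in 𝓝 z₀, q z = 0 → z ≠ z₀ → u z < Φ z)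
    (hsub : ∀ᶠ z in 𝓝 z₀, ∀ Ψ : E → ℝ, IsTestFunction (E := E) u Ψ z →
      0 ≤ planeLaplacian G P Ψ z) :
    0 ≤ planeLaplacian G P Φ z₀ := by
  obtain ⟨C, hC, hCq⟩ := hLq.exists_pos
  refine le_of_forall_pos_le_add fun ε hε => ?_
  have hLΦε : ∀ᶠ z in 𝓝 z₀, planeLaplacian G P Φ z < planeLaplacian G P Φ z₀ + ε / 2 :=
    hLΦ.eventually_lt_const (by linarith)
  obtain ⟨t, ht, z, ⟨⟨hz₁, hz₂⟩, hz₃⟩, htq, hΦz, hqz, s, htest⟩ := exists_isTestFunction_penalized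
    husc htop hΦ hq hq_nonneg h₀ hq₀ hlt ((hLΦε.and hCq.bound).and hsub)
    (η := ε / 2 / C) (by positivity)
  rw [Real.norm_of_nonneg (hq_nonneg z)] at hz₂
  calc 0 ≤ planeLaplacian G P (fun w => Φ w + t * q w + s) z := hz₃ _ htest
    _ = planeLaplacian G P Φ z + t * planeLaplacian G P q z :=
      planeLaplacian_add_const_mul_add_const hΦz hqz t s
    _ ≤ (planeLaplacian G P Φ z₀ + ε / 2) + t * (C * q z) := by
      gcongr
      exact (Real.le_norm_self _).trans hz₂
    _ = (planeLaplacian G P Φ z₀ + ε / 2) + (t * q z) * C := by ring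
    _ ≤ (planeLaplacian G P Φ z₀ + ε / 2) + ε / 2 / C * C := by gcongr
    _ = planeLaplacian G P Φ z₀ + ε := by rw [div_mul_cancel₀ _ hC.ne']; ring

end PenalizedLaplacian

/-! ### Germs of minimal immersions -/

section Penalty

variable {E H : Type*} [NormedAddCommGroup E] [NormedSpace ℝ E]
  [NormedAddCommGroup H] [NormedSpace ℝ H]

theorem eventually_contDiffAt_two {n : WithTop ℕ∞} {B : E → H} {x : E} (hB : ContDiffAt ℝ n B x)
    (hn : 2 ≤ n) : ∀ᶠ y in 𝓝 x, ContDiffAt ℝ 2 B y :=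
  (hB.of_le hn).eventually (by simp)

theorem isBigO_sub_of_comp_eq_zero {B : E → H} {s : E → E} {z₀ : E}
    (hB : ContDiffAt ℝ 1 B z₀) (hs : Tendsto s (𝓝 z₀) (𝓝 z₀))
    (hBs : ∀ᶠ z in 𝓝 z₀, B (s z) = 0) : B =O[𝓝 z₀] fun z => z - s z := by
  obtain ⟨C, T, hT, hC⟩ := hB.exists_lipschitzOnWith
  refine .of_bound C ?_
  filter_upwards [hT, hs.eventually_mem hT, hBs] with z hz hsz hBz
  simpa only [hBz, sub_zero] using hC.norm_sub_le hz hsz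

variable [FiniteDimensional ℝ E]

theorem exists_strict_majorant (G : E → E →L[ℝ] E →L[ℝ] ℝ) {φ : E → ℝ} {a : E}
    (hφ : ContDiffAt ℝ 2 φ a) :
    ∃ φ' : E → ℝ, ContDiffAt ℝ 2 φ' a ∧ φ' a = φ a ∧ (∀ x, x ≠ a → φ x < φ' x) ∧
      coordHessian G φ' a = coordHessian G φ a := by
  set N : E → ℝ := fun x => ‖toEuclidean (x - a)‖ ^ 2
  have hN : ContDiffAt ℝ 2 N a :=
    (toEuclidean.contDiff.contDiffAt.comp a (contDiffAt_id.sub contDiffAt_const)).norm_sq ℝ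
  have hNa : N a = 0 := by simp [N]
  have hdN : fderiv ℝ N a = 0 :=
    IsLocalMin.fderiv_eq_zero (.of_forall fun x => hNa.trans_le (sq_nonneg _))
  have hN2 : ContDiffAt ℝ 2 (fun x => N x ^ 2 / 2) a := (hN.pow 2).div_const 2
  refine ⟨fun x => φ x + 1 * (N x ^ 2 / 2) + 0, (hφ.add (contDiffAt_const.mul hN2)).add
    contDiffAt_const, by simp [hNa], fun x hx => ?_, ?_⟩
  · have : 0 < N x := by
      have : toEuclidean (x - a) ≠ 0 := by simpa [sub_eq_zero] using hx
      positivity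
    simp only [one_mul, add_zero]
    exact lt_add_of_pos_right _ (by positivity)
  · rw [coordHessian_add_const_mul_add_const G hφ hN2, coordHessian_half_sq G hN, hdN, hNa]
    ext
    simp

variable {F : Type*}

/-- The components of `z - f (r z)` in fixed linear coordinates; for a left inverse `r` of `f` they
vanish exactly on the image of `f`. -/
def defect (f : F → E) (r : E → F) (i : Fin (Module.finrank ℝ E)) (z : E) : ℝ :=
  toEuclidean (z - f (r z)) i

/-- The penalty: half the square of the Euclidean length of `z - f (r z)`. -/
def penalty (f : F → E) (r : E → F) (z : E) : ℝ :=
  ∑ i, defect f r i z ^ 2 / 2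

theorem norm_toEuclidean_sub_sq (f : F → E) (r : E → F) (z : E) :
    ‖toEuclidean (z - f (r z))‖ ^ 2 = 2 * penalty f r z := by
  simp only [EuclideanSpace.norm_sq_eq, Real.norm_eq_abs, sq_abs, penalty, defect, Finset.mul_sum,
    mul_div_cancel₀ _ (two_ne_zero' ℝ)]

theorem penalty_nonneg (f : F → E) (r : E → F) (z : E) : 0 ≤ penalty f r z :=
  Finset.sum_nonneg fun _ _ => by positivity

theorem penalty_eq_zero_iff {f : F → E} {r : E → F} {z : E} : penalty f r z = 0 ↔ f (r z) = z := by
  rw [← mul_eq_zero_iff_left (two_ne_zero' ℝ), ← norm_toEuclidean_sub_sq, sq_eq_zero_iff,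
    norm_eq_zero, map_eq_zero_iff _ toEuclidean.injective, sub_eq_zero, eq_comm]

theorem norm_sub_sq_isBigO_penalty (f : F → E) (r : E → F) (l : Filter E) :
    (fun z => ‖z - f (r z)‖ * ‖z - f (r z)‖) =O[l] penalty f r := by
  have h : (fun z => z - f (r z)) =O[l] fun z => toEuclidean (z - f (r z)) := by
    simpa using (toEuclidean (E := E)).symm.isBigO_comp (fun z => toEuclidean (z - f (r z))) l
  refine (h.norm_norm.mul h.norm_norm).trans (.of_bound 2 (.of_forall fun z => ?_))
  rw [← sq, norm_toEuclidean_sub_sq, norm_mul, Real.norm_two]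

theorem defect_isBigO (f : F → E) (r : E → F) (i : Fin (Module.finrank ℝ E)) (l : Filter E) :
    defect f r i =O[l] fun z => z - f (r z) :=
  ((EuclideanSpace.proj i).comp (toEuclidean (E := E)).toContinuousLinearMap).isBigO_comp _ l

end Penalty

section MinimalImmersionGerms

variable {E F : Type*} [NormedAddCommGroup E] [NormedSpace ℝ E]
  [NormedAddCommGroup F] [NormedSpace ℝ F]

/-- The germ at `a` of a minimal immersion `f` for the metric `G`, together with a left inverse `r`
and a field `P` of orthogonal projections which extends the projections onto the tangent planes
of `f`. -/
structure MinimalImmersionGerm (G : E → E →L[ℝ] E →L[ℝ] ℝ) (f : F → E) (r : E → F)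
    (P : E → E →L[ℝ] E) (a : F) : Prop where
  metric : ContDiffAt ℝ 2 G (f a)
  pos : ∀ᶠ z in 𝓝 (f a), PosDef (G z)
  symm : ∀ᶠ z in 𝓝 (f a), ∀ v w, G z v w = G z w v
  immersion : ContDiffAt ℝ 3 f a
  injective : ∀ᶠ x in 𝓝 a, Function.Injective (fderiv ℝ f x)
  minimal : ∀ᶠ x in 𝓝 a, IsMinimalAt G f x
  leftInv : ContDiffAt ℝ 3 r (f a)
  leftInv_apply : ∀ᶠ x in 𝓝 a, r (f x) = x
  proj : ContDiffAt ℝ 1 P (f a)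
  proj_eq_orthProj : ∀ᶠ z in 𝓝 (f a), ∃ S, P z = orthProj (G z) S
  proj_tangent : ∀ᶠ x in 𝓝 a, P (f x) = orthProj (G (f x)) (fderiv ℝ f x).range

namespace MinimalImmersionGerm

variable {G : E → E →L[ℝ] E →L[ℝ] ℝ} {f : F → E} {r : E → F} {P : E → E →L[ℝ] E} {a : F}

theorem leftInv_self (h : MinimalImmersionGerm G f r P a) : r (f a) = a :=
  h.leftInv_apply.self_of_nhds

theorem tendsto_leftInv (h : MinimalImmersionGerm G f r P a) : Tendsto r (𝓝 (f a)) (𝓝 a) := by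
  simpa only [ContinuousAt, h.leftInv_self] using h.leftInv.continuousAt

theorem tendsto_retraction (h : MinimalImmersionGerm G f r P a) :
    Tendsto (fun z => f (r z)) (𝓝 (f a)) (𝓝 (f a)) :=
  h.immersion.continuousAt.tendsto.comp h.tendsto_leftInv

theorem contDiffAt_comp_leftInv {H : Type*} [NormedAddCommGroup H] [NormedSpace ℝ H]
    {k : WithTop ℕ∞} (h : MinimalImmersionGerm G f r P a) (hk : k ≤ 3) {φ : F → H}
    (hφ : ContDiffAt ℝ k φ a) : ContDiffAt ℝ k (fun z => φ (r z)) (f a) := by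
  rw [← h.leftInv_self] at hφ
  exact hφ.comp (f a) (h.leftInv.of_le hk)

variable [FiniteDimensional ℝ E]

theorem contDiffAt_defect (h : MinimalImmersionGerm G f r P a)
    (i : Fin (Module.finrank ℝ E)) : ContDiffAt ℝ 3 (defect f r i) (f a) :=
  have hz : ContDiffAt ℝ 3 (fun z => z - f (r z)) (f a) :=
    contDiffAt_id.sub (h.contDiffAt_comp_leftInv le_rfl h.immersion)
  ((EuclideanSpace.proj i).comp
    (toEuclidean (E := E)).toContinuousLinearMap).contDiff.contDiffAt.comp (f a) hz

theorem eventually_defect_comp_eq_zero (h : MinimalImmersionGerm G f r P a)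
    (i : Fin (Module.finrank ℝ E)) : ∀ᶠ x in 𝓝 a, defect f r i ∘ f =ᶠ[𝓝 x] fun _ => 0 :=
  (h.leftInv_apply.mono fun x hx => by simp [defect, hx]).eventually_nhds

theorem contDiffAt_penalty (h : MinimalImmersionGerm G f r P a) :
    ContDiffAt ℝ 3 (penalty f r) (f a) :=
  ContDiffAt.sum fun i _ => ((h.contDiffAt_defect i).pow 2).div_const 2

theorem contDiffAt_planeLaplacian (h : MinimalImmersionGerm G f r P a) {m k : WithTop ℕ∞}
    (hm : m ≤ 1) {Φ : E → ℝ} (hΦ : ContDiffAt ℝ k Φ (f a)) (hmk : m + 1 + 1 ≤ k) :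
    ContDiffAt ℝ m (planeLaplacian G P Φ) (f a) :=
  Pluri.contDiffAt_planeLaplacian h.metric ((add_le_add_left hm 1).trans one_add_one_eq_two.le)
    h.pos.self_of_nhds (h.proj.of_le hm) hΦ hmk

theorem fderiv_defect_comp_proj_isBigO (h : MinimalImmersionGerm G f r P a)
    (i : Fin (Module.finrank ℝ E)) :
    (fun z => (fderiv ℝ (defect f r i) z).comp (P z)) =O[𝓝 (f a)] fun z => z - f (r z) := by
  refine isBigO_sub_of_comp_eq_zero (((h.contDiffAt_defect i).fderiv_right (by norm_num)).clm_comp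
    h.proj) h.tendsto_retraction (h.tendsto_leftInv.eventually
      (p := fun x => (fderiv ℝ (defect f r i) (f x)).comp (P (f x)) = 0) ?_)
  filter_upwards [h.proj_tangent, h.eventually_defect_comp_eq_zero i,
    eventually_contDiffAt_two h.immersion (by norm_num), h.immersion.continuousAt.eventually
      (eventually_contDiffAt_two (h.contDiffAt_defect i) (by norm_num))] with x hP hx hf hd
  have hchain : (fderiv ℝ (defect f r i) (f x)).comp (fderiv ℝ f x) = 0 := by
    rw [← fderiv_comp x (hd.differentiableAt two_ne_zero) (hf.differentiableAt two_ne_zero),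
      hx.fderiv_eq, fderiv_fun_const, Pi.zero_apply]
  ext v
  obtain ⟨w, hw⟩ := orthProj_mem (G (f x)) (fderiv ℝ f x).range v
  rw [hP, ContinuousLinearMap.comp_apply, ← hw]
  exact DFunLike.congr_fun hchain w

variable [FiniteDimensional ℝ F]

theorem eventually_planeLaplacian_comp (h : MinimalImmersionGerm G f r P a) :
    ∀ᶠ x in 𝓝 a, ∀ Φ : E → ℝ, ContDiffAt ℝ 2 Φ (f x) → planeLaplacian G P Φ (f x) =
      traceWrt (pullbackMetric G f x) (coordHessian (pullbackMetric G f) (Φ ∘ f) x) := by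
  have hf := h.immersion.continuousAt
  filter_upwards [hf.eventually h.pos, hf.eventually h.symm,
    eventually_contDiffAt_two h.immersion (by norm_num), h.injective, h.proj_tangent, h.minimal,
    hf.eventually (eventually_differentiableAt h.metric)] with x hpos hsymm hfx hinj hP hmin hG Φ hΦ
  rw [planeLaplacian_eq_traceOn hpos hP, hmin.traceOn_coordHessian hG hpos hsymm hfx hinj hΦ]

theorem planeLaplacian_defect_isBigO (h : MinimalImmersionGerm G f r P a)
    (i : Fin (Module.finrank ℝ E)) :
    planeLaplacian G P (defect f r i) =O[𝓝 (f a)] fun z => z - f (r z) := by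
  refine isBigO_sub_of_comp_eq_zero
    (h.contDiffAt_planeLaplacian le_rfl (h.contDiffAt_defect i) (by norm_num))
    h.tendsto_retraction (h.tendsto_leftInv.eventually
      (p := fun x => planeLaplacian G P (defect f r i) (f x) = 0) ?_)
  filter_upwards [h.eventually_planeLaplacian_comp, h.eventually_defect_comp_eq_zero i,
    h.immersion.continuousAt.eventually
      (eventually_contDiffAt_two (h.contDiffAt_defect i) (by norm_num))] with x hL hx hd
  rw [hL _ hd, coordHessian_congr .rfl hx, coordHessian_zero]
  simp [traceWrt]

/-- The penalty is quadratic in the distance to the image of `f`, and both the `P`-gradient and the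
`P`-Laplacian of the defect vanish along the image: the former since the defect is constant on it,
the latter by minimality. -/
theorem planeLaplacian_penalty_isBigO (h : MinimalImmersionGerm G f r P a) :
    planeLaplacian G P (penalty f r) =O[𝓝 (f a)] penalty f r := by
  have hexpand : planeLaplacian G P (penalty f r) =ᶠ[𝓝 (f a)] fun z => ∑ i,
      ((fderiv ℝ (defect f r i) z).comp (P z)
        ((G z).inverse ((fderiv ℝ (defect f r i) z).comp (P z))) +
          defect f r i z * planeLaplacian G P (defect f r i) z) := by
    filter_upwards [h.pos, h.proj_eq_orthProj, eventually_all.2 fun i =>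
      eventually_contDiffAt_two (h.contDiffAt_defect i) (by norm_num)] with z hpos ⟨S, hS⟩ hd
    exact (planeLaplacian_finset_sum _ fun i _ => ((hd i).pow 2).div_const 2).trans
      (Finset.sum_congr rfl fun i _ => planeLaplacian_half_sq hpos hS (hd i))
  refine hexpand.trans_isBigO (.fun_sum fun i _ => .add ?_ ?_)
  · have hα := (h.fderiv_defect_comp_proj_isBigO i).norm_norm
    have hGinv : (fun z => (G z).inverse) =O[𝓝 (f a)] fun _ => (1 : ℝ) :=
      (contDiffAt_inverse h.metric
        h.pos.self_of_nhds.isInvertible).continuousAt.tendsto.isBigO_one ℝ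
    refine .trans (.of_norm_le fun z => ?_) (hα.mul (hGinv.norm_left.mul hα) |>.trans ?_)
    · exact (ContinuousLinearMap.le_opNorm _ _).trans
        (by gcongr; exact ContinuousLinearMap.le_opNorm _ _)
    · simpa only [one_mul] using norm_sub_sq_isBigO_penalty f r (𝓝 (f a))
  · exact ((defect_isBigO f r i _).norm_right.mul
      (h.planeLaplacian_defect_isBigO i).norm_right).trans (norm_sub_sq_isBigO_penalty f r _)

theorem laplacian_nonneg (h : MinimalImmersionGerm G f r P a) {u : E → EReal}
    (husc : ∀ᶠ z in 𝓝 (f a), UpperSemicontinuousAt u z) (htop : ∀ᶠ z in 𝓝 (f a), u z ≠ ⊤)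
    (hsub : ∀ᶠ z in 𝓝 (f a), ∀ Ψ : E → ℝ, IsTestFunction (E := E) u Ψ z →
      0 ≤ planeLaplacian G P Ψ z)
    {φ : F → ℝ} (hφ : IsTestFunction (E := F) (u ∘ f) φ a) :
    0 ≤ traceWrt (pullbackMetric G f a) (coordHessian (pullbackMetric G f) φ a) := by
  obtain ⟨φ', hφ', hφ'a, hlt, hHess⟩ :=
    exists_strict_majorant (pullbackMetric G f) hφ.contMDiffAt.contDiffAt
  have hΦ : ContDiffAt ℝ 2 (fun z => φ' (r z)) (f a) :=
    h.contDiffAt_comp_leftInv (by norm_num) hφ'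
  have hrestrict : (fun z => φ' (r z)) ∘ f =ᶠ[𝓝 a] φ' :=
    h.leftInv_apply.mono fun x hx => congrArg φ' hx
  rw [← hHess, ← coordHessian_congr .rfl hrestrict,
    ← h.eventually_planeLaplacian_comp.self_of_nhds _ hΦ]
  refine planeLaplacian_nonneg_of_penalty
    (h.contDiffAt_planeLaplacian zero_le_one hΦ (by norm_num)).continuousAt
    h.planeLaplacian_penalty_isBigO husc htop hΦ (h.contDiffAt_penalty.of_le (by norm_num))
    (penalty_nonneg f r) ?_ (penalty_eq_zero_iff.2 (congrArg f h.leftInv_self)) ?_ hsub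
  · rw [h.leftInv_self, hφ'a]
    exact hφ.eq
  · filter_upwards [h.tendsto_leftInv.eventually hφ.le] with z hz hqz hne
    rw [penalty_eq_zero_iff] at hqz
    rw [Function.comp_apply, hqz] at hz
    exact hz.trans_lt <| EReal.coe_lt_coe_iff.2 <| hlt _ fun hra => hne (by rw [← hqz, hra])

end MinimalImmersionGerm

end MinimalImmersionGerms

/-! ### Riemannian metrics in charts -/

section Charts

variable {E : Type*} [NormedAddCommGroup E] [NormedSpace ℝ E]
  {X : Type*} [TopologicalSpace X] [ChartedSpace E X]

instance finiteDimensional_tangentSpace [FiniteDimensional ℝ E] (x : X) :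
    FiniteDimensional ℝ (TangentSpace 𝓘(ℝ, E) x) :=
  inferInstanceAs (FiniteDimensional ℝ E)

instance t2Space_tangentSpace (x : X) : T2Space (TangentSpace 𝓘(ℝ, E) x) :=
  inferInstanceAs (T2Space E)

/-- The differential of the chart `c` at `x`, with values in the model space instead of its tangent
space at `c x`, so that the values at different points can be compared. -/
def chartDeriv (c : OpenPartialHomeomorph X E) (x : X) : TangentSpace 𝓘(ℝ, E) x →L[ℝ] E :=
  mfderiv 𝓘(ℝ, E) 𝓘(ℝ, E) c x

section AnyChart

variable {c : OpenPartialHomeomorph X E} (hc : c.MDifferentiable 𝓘(ℝ, E) 𝓘(ℝ, E))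
  {B : ∀ x : X, TangentSpace 𝓘(ℝ, E) x →L[ℝ] TangentSpace 𝓘(ℝ, E) x →L[ℝ] ℝ} {x : X}
include hc

theorem chartDeriv_injective (hx : x ∈ c.source) : Function.Injective (chartDeriv c x) :=
  hc.mfderiv_injective hx

theorem pullback_metricInChart
    (B : ∀ x : X, TangentSpace 𝓘(ℝ, E) x →L[ℝ] TangentSpace 𝓘(ℝ, E) x →L[ℝ] ℝ)
    (hx : x ∈ c.source) : pullback (metricInChart c B (c x)) (chartDeriv c x) = B x := by
  have hid : ∀ v : TangentSpace 𝓘(ℝ, E) x, (mfderiv 𝓘(ℝ, E) 𝓘(ℝ, E) c.symm (c x) :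
      E →L[ℝ] E) (mfderiv 𝓘(ℝ, E) 𝓘(ℝ, E) c x v) = v := fun v =>
    congrArg (fun l : E →L[ℝ] E => l v) (hc.symm_comp_deriv hx)
  have hbase : ∀ y, y = x → ∀ v w : E,
      (B y : E →L[ℝ] E →L[ℝ] ℝ) v w = (B x : E →L[ℝ] E →L[ℝ] ℝ) v w := by
    rintro _ rfl _ _
    rfl
  ext v w
  refine (hbase _ (c.left_inv hx) _ _).trans ?_
  exact congrArg₂ (fun v w => (B x : E →L[ℝ] E →L[ℝ] ℝ) v w) (hid v) (hid w)

theorem posDef_metricInChart (hB : ∀ x, PosDef (B x)) {z : E} (hz : z ∈ c.target) :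
    PosDef (metricInChart c B z) :=
  (hB _).pullback_of_injective (L := mfderiv 𝓘(ℝ, E) 𝓘(ℝ, E) c.symm z)
    (hc.symm.mfderiv_injective hz)

variable [FiniteDimensional ℝ E]

theorem traceOn_hessian (hB : ∀ x, PosDef (B x)) (hx : x ∈ c.source)
    (W : Submodule ℝ (TangentSpace 𝓘(ℝ, E) x)) (φ : X → ℝ) :
    traceOn (B x) W (hessian c B φ x) =
      traceOn (metricInChart c B (c x)) (W.map (chartDeriv c x : TangentSpace 𝓘(ℝ, E) x →ₗ[ℝ] E))
        (coordHessian (metricInChart c B) (φ ∘ c.symm) (c x)) := by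
  have h := (posDef_metricInChart hc hB (c.map_source hx)).traceOn_pullback
    (chartDeriv_injective hc hx) W (coordHessian (metricInChart c B) (φ ∘ c.symm) (c x))
  rwa [pullback_metricInChart hc B hx] at h

theorem traceWrt_pullback_chartDeriv (hB : ∀ x, PosDef (B x)) (hx : x ∈ c.source)
    (A : E →L[ℝ] E →L[ℝ] ℝ) :
    traceWrt (B x) (pullback A (chartDeriv c x)) = traceWrt (metricInChart c B (c x)) A := by
  have h := (posDef_metricInChart hc hB (c.map_source hx)).traceWrt_pullback_equiv
    (hc.mfderiv hx : TangentSpace 𝓘(ℝ, E) x ≃L[ℝ] E) A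
  change traceWrt (pullback _ (chartDeriv c x)) (pullback A (chartDeriv c x)) = _ at h
  rwa [pullback_metricInChart hc B hx] at h

theorem laplacian_eq (hB : ∀ x, PosDef (B x)) (hx : x ∈ c.source) (φ : X → ℝ) :
    laplacian c B φ x = traceWrt (metricInChart c B (c x))
      (coordHessian (metricInChart c B) (φ ∘ c.symm) (c x)) :=
  traceWrt_pullback_chartDeriv hc hB hx _

end AnyChart

theorem IsTestFunction.comp {D Y : Type*} [NormedAddCommGroup D] [NormedSpace ℝ D]
    [TopologicalSpace Y] [ChartedSpace D Y] {u : X → EReal} {φ : X → ℝ} {k : Y → X} {y : Y}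
    (hφ : IsTestFunction (E := E) u φ (k y)) (hk : ContMDiffAt 𝓘(ℝ, D) 𝓘(ℝ, E) 2 k y) :
    IsTestFunction (E := D) (u ∘ k) (φ ∘ k) y :=
  ⟨hφ.contMDiffAt.comp y hk, hk.continuousAt.eventually hφ.le, hφ.eq⟩

theorem IsTestFunction.congr {u v : X → EReal} {φ : X → ℝ} {x : X}
    (hφ : IsTestFunction (E := E) u φ x) (huv : u =ᶠ[𝓝 x] v) : IsTestFunction (E := E) v φ x :=
  ⟨hφ.contMDiffAt, by filter_upwards [hφ.le, huv] with y hy huvy using huvy ▸ hy,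
    huv.eq_of_nhds ▸ hφ.eq⟩

variable [IsManifold 𝓘(ℝ, E) ∞ X]

/-- The coordinate frame of the preferred chart at `x₀`: the inverse, at the point `x`, of the
differential of this chart. -/
def chartFrame (x₀ x : X) : E →L[ℝ] TangentSpace 𝓘(ℝ, E) x :=
  (trivializationAt E (TangentSpace 𝓘(ℝ, E)) x₀).symmL ℝ x

variable {x₀ x : X}

theorem chartDeriv_chartFrame (hx : x ∈ (chartAt E x₀).source) (v : E) :
    chartDeriv (chartAt E x₀) x (chartFrame x₀ x v) = v := by
  have h := (trivializationAt E (TangentSpace 𝓘(ℝ, E)) x₀).continuousLinearMapAt_symmL (R := ℝ)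
    (b := x) (by simpa using hx) v
  rwa [TangentBundle.continuousLinearMapAt_trivializationAt hx] at h

theorem chartFrame_chartDeriv (hx : x ∈ (chartAt E x₀).source) (v : TangentSpace 𝓘(ℝ, E) x) :
    chartFrame x₀ x (chartDeriv (chartAt E x₀) x v) = v := by
  have h := (trivializationAt E (TangentSpace 𝓘(ℝ, E)) x₀).symmL_continuousLinearMapAt (R := ℝ)
    (b := x) (by simpa using hx) v
  rwa [TangentBundle.continuousLinearMapAt_trivializationAt hx] at h

theorem contMDiffOn_chartFrame (x₀ : X) (v : E) :
    ContMDiffOn 𝓘(ℝ, E) (𝓘(ℝ, E).prod 𝓘(ℝ, E)) ∞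
      (fun x => Bundle.TotalSpace.mk' E (E := TangentSpace 𝓘(ℝ, E) (M := X)) x (chartFrame x₀ x v))
      (chartAt E x₀).source := by
  set e := trivializationAt E (TangentSpace 𝓘(ℝ, E) (M := X)) x₀
  have hbase : (chartAt E x₀).source ⊆ e.baseSet := fun x hx => by simpa [e] using hx
  refine (e.contMDiffOn_section_iff (chartAt E x₀).open_source hbase).2 ?_
  refine (contMDiffOn_const (c := v)).congr fun x hx => ?_
  rw [chartFrame, e.symmL_apply (hbase hx)]
  exact congrArg Prod.snd (e.apply_mk_symm (hbase hx) v)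

theorem metricInChart_apply (hx : x ∈ (chartAt E x₀).source)
    (B : ∀ x : X, TangentSpace 𝓘(ℝ, E) x →L[ℝ] TangentSpace 𝓘(ℝ, E) x →L[ℝ] ℝ) (v w : E) :
    metricInChart (chartAt E x₀) B (chartAt E x₀ x) v w =
      B x (chartFrame x₀ x v) (chartFrame x₀ x w) := by
  rw [← pullback_metricInChart (mdifferentiable_chart x₀) B hx, pullback_apply,
    chartDeriv_chartFrame hx, chartDeriv_chartFrame hx]

variable [FiniteDimensional ℝ E]

theorem contDiffOn_metricInChart
    (g : Bundle.ContMDiffRiemannianMetric 𝓘(ℝ, E) ∞ E (fun x : X => TangentSpace 𝓘(ℝ, E) x))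
    (x₀ : X) :
    ContDiffOn ℝ ∞ (metricInChart (chartAt E x₀) g.inner) (chartAt E x₀).target := by
  refine contDiffOn_clm_apply.2 fun v => contDiffOn_clm_apply.2 fun w => ?_
  have hmetric : ContMDiffOn 𝓘(ℝ, E) 𝓘(ℝ, ℝ) ∞
      (fun x => g.inner x (chartFrame x₀ x v) (chartFrame x₀ x w)) (chartAt E x₀).source := by
    have h := g.contMDiff.contMDiffOn.clm_bundle_apply₂ (F₁ := E) (F₂ := E)
      (contMDiffOn_chartFrame x₀ v) (contMDiffOn_chartFrame x₀ w)
    exact fun x hx => (Bundle.contMDiffWithinAt_totalSpace.1 (h x hx)).2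
  refine (hmetric.comp contMDiffOn_chart_symm (chartAt E x₀).mapsTo_symm).contDiffOn.congr ?_
  intro z hz
  rw [Function.comp_apply, ← metricInChart_apply ((chartAt E x₀).map_target hz),
    (chartAt E x₀).right_inv hz]

theorem inCoordinates_orthProj (hx : x ∈ (chartAt E x₀).source)
    {B : ∀ x : X, TangentSpace 𝓘(ℝ, E) x →L[ℝ] TangentSpace 𝓘(ℝ, E) x →L[ℝ] ℝ}
    (hB : ∀ x, PosDef (B x)) (W : Submodule ℝ (TangentSpace 𝓘(ℝ, E) x)) :
    ContinuousLinearMap.inCoordinates E (TangentSpace 𝓘(ℝ, E)) E (TangentSpace 𝓘(ℝ, E))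
      x₀ x x₀ x (orthProj (B x) W) =
    orthProj (metricInChart (chartAt E x₀) B (chartAt E x₀ x))
      (W.map (chartDeriv (chartAt E x₀) x : TangentSpace 𝓘(ℝ, E) x →ₗ[ℝ] E)) := by
  have hc := mdifferentiable_chart (I := 𝓘(ℝ, E)) x₀
  ext1 v
  have h := (posDef_metricInChart hc hB ((chartAt E x₀).map_source hx)).orthProj_map
    (chartDeriv_injective hc hx) W (chartFrame x₀ x v)
  rw [chartDeriv_chartFrame hx, pullback_metricInChart hc B hx] at h
  rw [ContinuousLinearMap.inCoordinates, TangentBundle.continuousLinearMapAt_trivializationAt hx]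
  exact h.symm

end Charts

/-! ### Plane fields from the retraction -/

section LocalLeftInverse

variable {E F : Type*} [NormedAddCommGroup E] [NormedSpace ℝ E] [FiniteDimensional ℝ E]
  [NormedAddCommGroup F] [NormedSpace ℝ F] [FiniteDimensional ℝ F]

theorem exists_contDiffAt_leftInverse {k : WithTop ℕ∞} {f : F → E} {a : F}
    (hf : ContDiffAt ℝ k f a) (hk : k ≠ 0) (hinj : Function.Injective (fderiv ℝ f a)) :
    ∃ r : E → F, ContDiffAt ℝ k r (f a) ∧ ∀ᶠ x in 𝓝 a, r (f x) = x := by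
  obtain ⟨l, hl⟩ := LinearMap.exists_leftInverse_of_injective (fderiv ℝ f a : F →ₗ[ℝ] E)
    (LinearMap.ker_eq_bot.2 hinj)
  let L : E →L[ℝ] F := LinearMap.toContinuousLinearMap l
  have hLf : ContDiffAt ℝ k (fun x => L (f x)) a := L.contDiff.contDiffAt.comp a hf
  have hid : L.comp (fderiv ℝ f a) = (ContinuousLinearEquiv.refl ℝ F : F →L[ℝ] F) := by
    ext v
    exact congrArg (fun k : F →ₗ[ℝ] F => k v) hl
  have hLf' : HasFDerivAt (fun x => L (f x)) (ContinuousLinearEquiv.refl ℝ F : F →L[ℝ] F) a :=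
    hid ▸ L.hasFDerivAt.comp a (hf.differentiableAt hk).hasFDerivAt
  exact ⟨fun z => hLf.localInverse hLf' hk (L z),
    (hLf.to_localInverse hLf' hk).comp (f a) L.contDiff.contDiffAt,
    (hLf.hasStrictFDerivAt' hLf' hk).eventually_left_inverse⟩

end LocalLeftInverse

section PlaneFields

variable {E F : Type*} [NormedAddCommGroup E] [NormedSpace ℝ E] [FiniteDimensional ℝ E]
  [NormedAddCommGroup F] [NormedSpace ℝ F]

theorem contDiffAt_orthProj_range [FiniteDimensional ℝ F] {D : Type*} [NormedAddCommGroup D]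
    [NormedSpace ℝ D] {k : WithTop ℕ∞} {G : D → E →L[ℝ] E →L[ℝ] ℝ} {l : D → F →L[ℝ] E} {z : D}
    (hG : ContDiffAt ℝ k G z) (hpos : ∀ᶠ y in 𝓝 z, PosDef (G y))
    (hl : ContDiffAt ℝ k l z) (hinj : ∀ᶠ y in 𝓝 z, Function.Injective (l y)) :
    ContDiffAt ℝ k (fun y => orthProj (G y) (l y).range) z := by
  have hinv : ContDiffAt ℝ k (fun y => (pullback (G y) (l y)).inverse) z :=
    contDiffAt_inverse (contDiffAt_pullback hG hl)
      (hpos.self_of_nhds.pullback_of_injective hinj.self_of_nhds).isInvertible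
  have hprecomp : ContDiffAt ℝ k (fun y => (ContinuousLinearMap.compL ℝ F E ℝ).flip (l y)) z :=
    (ContinuousLinearMap.compL ℝ F E ℝ).flip.contDiff.contDiffAt.comp z hl
  refine (hl.clm_comp (hinv.clm_comp (hprecomp.clm_comp hG))).congr_of_eventuallyEq ?_
  filter_upwards [hpos, hinj] with y hy hly
  exact hy.orthProj_range hly

variable {X : Type*} [TopologicalSpace X] [ChartedSpace E X] [IsManifold 𝓘(ℝ, E) ∞ X]

/-- The subspace of the tangent space at `x` whose expression in the preferred chart at `x₀` is the
range of `l`. -/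
def chartPlane (x₀ x : X) (l : F →L[ℝ] E) : Submodule ℝ (TangentSpace 𝓘(ℝ, E) x) :=
  ((chartFrame x₀ x).comp l).range

omit [FiniteDimensional ℝ E] in
theorem map_chartPlane {x₀ x : X} (hx : x ∈ (chartAt E x₀).source) (l : F →L[ℝ] E) :
    (chartPlane x₀ x l).map (chartDeriv (chartAt E x₀) x : TangentSpace 𝓘(ℝ, E) x →ₗ[ℝ] E) =
      l.range := by
  ext v
  constructor
  · rintro ⟨_, ⟨w, rfl⟩, rfl⟩
    exact ⟨w, (chartDeriv_chartFrame hx (l w)).symm⟩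
  · rintro ⟨w, rfl⟩
    exact ⟨chartFrame x₀ x (l w), ⟨w, rfl⟩, chartDeriv_chartFrame hx (l w)⟩

omit [FiniteDimensional ℝ E] in
theorem finrank_chartPlane {x₀ x : X} (hx : x ∈ (chartAt E x₀).source) {l : F →L[ℝ] E}
    (hl : Function.Injective l) :
    Module.finrank ℝ (chartPlane x₀ x l) = Module.finrank ℝ F := by
  have hframe : Function.Injective (chartFrame x₀ x) :=
    Function.LeftInverse.injective (chartDeriv_chartFrame hx)
  exact LinearMap.finrank_range_of_inj
    (f := (((chartFrame x₀ x).comp l : F →L[ℝ] TangentSpace 𝓘(ℝ, E) x) :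
      F →ₗ[ℝ] TangentSpace 𝓘(ℝ, E) x)) (hframe.comp hl)

variable (g : Bundle.ContMDiffRiemannianMetric 𝓘(ℝ, E) ∞ E (fun x : X => TangentSpace 𝓘(ℝ, E) x))

/-- The coordinate plane field `z ↦ range (l z)`, seen as a field of planes tangent to `X` and
embedded into `End(TX)` as in `grassmannEmbedding`.  The planes are not required to have a given
dimension, since this only holds near the point of interest. -/
def embeddedPlaneField (x₀ : X) (l : E → F →L[ℝ] E) (z : E) :
    Bundle.TotalSpace (E →L[ℝ] E)
      (fun x : X => TangentSpace 𝓘(ℝ, E) x →L[ℝ] TangentSpace 𝓘(ℝ, E) x) :=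
  ⟨(chartAt E x₀).symm z, orthProj (g.inner ((chartAt E x₀).symm z))
    (chartPlane x₀ ((chartAt E x₀).symm z) (l z))⟩

/-- The coordinate expression of an endomorphism of a tangent space in the preferred chart at
`x₀`. -/
def endInChart (x₀ : X) (y : Bundle.TotalSpace (E →L[ℝ] E)
    (fun x : X => TangentSpace 𝓘(ℝ, E) x →L[ℝ] TangentSpace 𝓘(ℝ, E) x)) : E →L[ℝ] E :=
  ContinuousLinearMap.inCoordinates E (TangentSpace 𝓘(ℝ, E)) E (TangentSpace 𝓘(ℝ, E))
    x₀ y.proj x₀ y.proj y.snd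

theorem endInChart_embeddedPlaneField (x₀ : X) (l : E → F →L[ℝ] E) {z : E}
    (hz : z ∈ (chartAt E x₀).target) :
    endInChart x₀ (embeddedPlaneField g x₀ l z) =
      orthProj (metricInChart (chartAt E x₀) g.inner z) (l z).range := by
  have hx := (chartAt E x₀).map_target hz
  rw [endInChart, embeddedPlaneField, inCoordinates_orthProj hx fun x => g.pos x,
    map_chartPlane hx, (chartAt E x₀).right_inv hz]

theorem contMDiffAt_embeddedPlaneField [FiniteDimensional ℝ F] {x₀ : X} {l : E → F →L[ℝ] E}
    (hl : ContDiffAt ℝ ∞ l (chartAt E x₀ x₀))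
    (hinj : ∀ᶠ z in 𝓝 (chartAt E x₀ x₀), Function.Injective (l z)) :
    ContMDiffAt 𝓘(ℝ, E) (𝓘(ℝ, E).prod 𝓘(ℝ, E →L[ℝ] E)) ∞ (embeddedPlaneField g x₀ l)
      (chartAt E x₀ x₀) := by
  have hnhds : (chartAt E x₀).target ∈ 𝓝 (chartAt E x₀ x₀) := chart_target_mem_nhds E x₀
  have hpos : ∀ᶠ z in 𝓝 (chartAt E x₀ x₀), PosDef (metricInChart (chartAt E x₀) g.inner z) :=
    mem_of_superset hnhds fun z hz =>
      posDef_metricInChart (mdifferentiable_chart x₀) (fun x => g.pos x) hz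
  have hcoord : ContMDiffAt 𝓘(ℝ, E) 𝓘(ℝ, E →L[ℝ] E) ∞
      (fun z => endInChart x₀ (embeddedPlaneField g x₀ l z)) (chartAt E x₀ x₀) :=
    ((contDiffAt_orthProj_range ((contDiffOn_metricInChart g x₀).contDiffAt hnhds) hpos hl
      hinj).contMDiffAt).congr_of_eventuallyEq <|
      mem_of_superset hnhds fun z hz => endInChart_embeddedPlaneField g x₀ l hz
  refine (contMDiffAt_hom_bundle _).2 ⟨contMDiffOn_chart_symm.contMDiffAt hnhds, ?_⟩
  have hproj : (embeddedPlaneField g x₀ l (chartAt E x₀ x₀)).proj = x₀ :=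
    (chartAt E x₀).left_inv (mem_chart_source E x₀)
  rwa [hproj]

variable {g}

theorem HasSmoothFibrewiseRetraction.exists_section [FiniteDimensional ℝ F] {p : ℕ}
    {𝒢 : Set (GrassmannBundle E X p)} (hretr : HasSmoothFibrewiseRetraction g 𝒢) {x₀ : X}
    {l : E → F →L[ℝ] E} (hl : ContDiffAt ℝ ∞ l (chartAt E x₀ x₀))
    (hinj : ∀ᶠ z in 𝓝 (chartAt E x₀ x₀), Function.Injective (l z))
    (hmem : chartPlane x₀ ((chartAt E x₀).symm (chartAt E x₀ x₀)) (l (chartAt E x₀ x₀)) ∈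
      fibre 𝒢 ((chartAt E x₀).symm (chartAt E x₀ x₀))) :
    ∃ σ : E → Bundle.TotalSpace (E →L[ℝ] E)
        (fun x : X => TangentSpace 𝓘(ℝ, E) x →L[ℝ] TangentSpace 𝓘(ℝ, E) x),
      ContMDiffAt 𝓘(ℝ, E) (𝓘(ℝ, E).prod 𝓘(ℝ, E →L[ℝ] E)) ∞ σ (chartAt E x₀ x₀) ∧
      ∀ᶠ z in 𝓝 (chartAt E x₀ x₀),
        (∃ y ∈ 𝒢, y.base = (chartAt E x₀).symm z ∧ σ z = grassmannEmbedding g p y) ∧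
        (chartPlane x₀ ((chartAt E x₀).symm z) (l z) ∈ fibre 𝒢 ((chartAt E x₀).symm z) →
          σ z = embeddedPlaneField g x₀ l z) := by
  obtain ⟨_, ρ, ⟨O, hO, rfl⟩, h𝒢O, ⟨R, hR, hRρ⟩, hρ𝒢, hρid, hρbase⟩ := hretr
  obtain ⟨hrank₀, hmem₀⟩ := hmem
  have hnhds : (chartAt E x₀).target ∈ 𝓝 (chartAt E x₀ x₀) := chart_target_mem_nhds E x₀
  have hfield := contMDiffAt_embeddedPlaneField g hl hinj
  have hrank : Module.finrank ℝ F = p :=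
    (finrank_chartPlane ((chartAt E x₀).map_target (mem_of_mem_nhds hnhds))
      hinj.self_of_nhds).symm.trans hrank₀
  have hU : ∀ᶠ z in 𝓝 (chartAt E x₀ x₀), ∃ y : GrassmannBundle E X p,
      grassmannEmbedding g p y ∈ O ∧ grassmannEmbedding g p y = embeddedPlaneField g x₀ l z ∧
      y.base = (chartAt E x₀).symm z ∧
      (chartPlane x₀ ((chartAt E x₀).symm z) (l z) ∈ fibre 𝒢 ((chartAt E x₀).symm z) → y ∈ 𝒢) := by
    filter_upwards [hfield.continuousAt.eventually (hO.mem_nhds (h𝒢O hmem₀)), hinj, hnhds]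
      with z hzO hlz hz
    exact ⟨⟨_, chartPlane x₀ _ (l z), (finrank_chartPlane ((chartAt E x₀).map_target hz)
      hlz).trans hrank⟩, hzO, rfl, rfl, fun h => h.2⟩
  have himage : ∀ᶠ z in 𝓝 (chartAt E x₀ x₀), embeddedPlaneField g x₀ l z ∈
      grassmannEmbedding g p '' (grassmannEmbedding g p ⁻¹' O) :=
    hU.mono fun z ⟨y, hyO, hy, _⟩ => ⟨y, hyO, hy⟩
  refine ⟨fun z => R (embeddedPlaneField g x₀ l z), ?_, ?_⟩
  · exact ((hR _ himage.self_of_nhds).comp _ hfield.contMDiffWithinAt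
      (mapsTo_preimage _ _)).contMDiffAt himage
  · filter_upwards [hU] with z ⟨y, hyO, hy, hbase, hy𝒢⟩
    rw [← hy, hRρ y hyO]
    exact ⟨⟨ρ y, hρ𝒢 y hyO, (hρbase y hyO).trans hbase, rfl⟩, fun h => by rw [hρid y (hy𝒢 h)]⟩

theorem HasSmoothFibrewiseRetraction.exists_projection [FiniteDimensional ℝ F] {p : ℕ}
    {𝒢 : Set (GrassmannBundle E X p)} (hretr : HasSmoothFibrewiseRetraction g 𝒢) {x₀ : X}
    {l : E → F →L[ℝ] E} (hl : ContDiffAt ℝ ∞ l (chartAt E x₀ x₀))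
    (hinj : ∀ᶠ z in 𝓝 (chartAt E x₀ x₀), Function.Injective (l z))
    (hmem : chartPlane x₀ ((chartAt E x₀).symm (chartAt E x₀ x₀)) (l (chartAt E x₀ x₀)) ∈
      fibre 𝒢 ((chartAt E x₀).symm (chartAt E x₀ x₀))) :
    ∃ P : E → E →L[ℝ] E, ContDiffAt ℝ ∞ P (chartAt E x₀ x₀) ∧
      ∀ᶠ z in 𝓝 (chartAt E x₀ x₀),
        (∃ W ∈ fibre 𝒢 ((chartAt E x₀).symm z),
          P z = orthProj (metricInChart (chartAt E x₀) g.inner z)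
            (W.map (chartDeriv (chartAt E x₀) ((chartAt E x₀).symm z) :
              TangentSpace 𝓘(ℝ, E) ((chartAt E x₀).symm z) →ₗ[ℝ] E))) ∧
        (chartPlane x₀ ((chartAt E x₀).symm z) (l z) ∈ fibre 𝒢 ((chartAt E x₀).symm z) →
          P z = orthProj (metricInChart (chartAt E x₀) g.inner z) (l z).range) := by
  obtain ⟨σ, hσ, hσ𝒢⟩ := hretr.exists_section hl hinj hmem
  have hproj : (σ (chartAt E x₀ x₀)).proj = x₀ := by
    obtain ⟨⟨y, -, hbase, hy⟩, -⟩ := hσ𝒢.self_of_nhds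
    rw [hy]
    exact hbase.trans ((chartAt E x₀).left_inv (mem_chart_source E x₀))
  refine ⟨fun z => endInChart x₀ (σ z), ?_, ?_⟩
  · have hcoord := ((contMDiffAt_hom_bundle σ).1 hσ).2
    rw [hproj] at hcoord
    exact hcoord.contDiffAt
  · filter_upwards [hσ𝒢, chart_target_mem_nhds E x₀] with z ⟨⟨y, hy𝒢, hbase, hy⟩, hfix⟩ hz
    refine ⟨?_, fun h => by rw [hfix h, endInChart_embeddedPlaneField g x₀ l hz]⟩
    obtain ⟨_, W, hW⟩ := y
    obtain rfl := hbase
    refine ⟨W, ⟨hW, hy𝒢⟩, ?_⟩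
    rw [hy]
    refine (inCoordinates_orthProj ((chartAt E x₀).map_target hz) (fun x => g.pos x) W).trans ?_
    rw [(chartAt E x₀).right_inv hz]

end PlaneFields

/-! ### Immersions in charts -/

section ImmersionsInCharts

variable {E F : Type*} [NormedAddCommGroup E] [NormedSpace ℝ E]
  [NormedAddCommGroup F] [NormedSpace ℝ F]
  {X : Type*} [TopologicalSpace X] [ChartedSpace E X]
  {M : Type*} [TopologicalSpace M] [ChartedSpace F M]

/-- The differential of `ι : M → X` in the coordinate frame of the chart `d` of `M`. -/
def frameDeriv (d : OpenPartialHomeomorph M F) (ι : M → X) (x : F) :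
    F →L[ℝ] TangentSpace 𝓘(ℝ, E) (ι (d.symm x)) :=
  (mfderiv 𝓘(ℝ, F) 𝓘(ℝ, E) ι (d.symm x)).comp
    (mfderiv 𝓘(ℝ, F) 𝓘(ℝ, F) d.symm x : F →L[ℝ] TangentSpace 𝓘(ℝ, F) (d.symm x))

section Differential

variable {c : OpenPartialHomeomorph X E} {d : OpenPartialHomeomorph M F} {ι : M → X} {x : F}
  (hd : d.MDifferentiable 𝓘(ℝ, F) 𝓘(ℝ, F)) (hx : x ∈ d.target)
include hd hx

theorem frameDeriv_injective
    (hinj : Function.Injective (mfderiv 𝓘(ℝ, F) 𝓘(ℝ, E) ι (d.symm x))) :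
    Function.Injective (frameDeriv (E := E) d ι x) :=
  hinj.comp (hd.symm.mfderiv_injective hx)

theorem range_frameDeriv (ι : M → X) :
    (frameDeriv (E := E) d ι x).range = (mfderiv 𝓘(ℝ, F) 𝓘(ℝ, E) ι (d.symm x)).range :=
  LinearMap.range_comp_of_range_eq_top _ (LinearMap.range_eq_top.2 (hd.symm.mfderiv_surjective hx))

theorem fderiv_coord (hc : c.MDifferentiable 𝓘(ℝ, E) 𝓘(ℝ, E))
    (hι : MDifferentiable 𝓘(ℝ, F) 𝓘(ℝ, E) ι) (hxc : ι (d.symm x) ∈ c.source) :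
    fderiv ℝ (c ∘ ι ∘ d.symm) x = (chartDeriv c (ι (d.symm x))).comp (frameDeriv d ι x) := by
  have hdx := hd.mdifferentiableAt_symm hx
  rw [← mfderiv_eq_fderiv]
  refine (mfderiv_comp x (hc.mdifferentiableAt hxc) ((hι _).comp x hdx)).trans ?_
  rw [mfderiv_comp x (hι _) hdx]
  rfl

theorem metricInChart_fderiv_coord (hc : c.MDifferentiable 𝓘(ℝ, E) 𝓘(ℝ, E))
    (hι : MDifferentiable 𝓘(ℝ, F) 𝓘(ℝ, E) ι) (hxc : ι (d.symm x) ∈ c.source)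
    (B : ∀ x : X, TangentSpace 𝓘(ℝ, E) x →L[ℝ] TangentSpace 𝓘(ℝ, E) x →L[ℝ] ℝ)
    (ζ : TangentSpace 𝓘(ℝ, E) (ι (d.symm x))) (v : F) :
    metricInChart c B ((c ∘ ι ∘ d.symm) x) (chartDeriv c (ι (d.symm x)) ζ)
      (fderiv ℝ (c ∘ ι ∘ d.symm) x v) = B (ι (d.symm x)) ζ (frameDeriv d ι x v) := by
  rw [fderiv_coord hd hx hc hι hxc, ← pullback_metricInChart hc B hxc]
  rfl

end Differential

variable [IsManifold 𝓘(ℝ, E) ∞ X]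
  {g : Bundle.ContMDiffRiemannianMetric 𝓘(ℝ, E) ∞ E (fun x : X => TangentSpace 𝓘(ℝ, E) x)}

theorem posDef_inducedMetric {ι : M → X}
    (hinj : ∀ m, Function.Injective (mfderiv 𝓘(ℝ, F) 𝓘(ℝ, E) ι m)) (m : M) :
    PosDef (inducedMetric (F := F) g ι m) :=
  PosDef.pullback_of_injective (fun v hv => g.pos _ v hv) (hinj m)

variable [IsManifold 𝓘(ℝ, F) ∞ M]
  {c : OpenPartialHomeomorph X E} (hc : c ∈ atlas E X)
  {d : OpenPartialHomeomorph M F} (hd : d ∈ atlas F M)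
  {ι : M → X} {x : F} (hx : x ∈ d.target) (hxc : ι (d.symm x) ∈ c.source)
include hc hd hx hxc

theorem contDiffAt_coord (hι : ContMDiff 𝓘(ℝ, F) 𝓘(ℝ, E) ∞ ι) :
    ContDiffAt ℝ ∞ (c ∘ ι ∘ d.symm) x := by
  have hcι : ContMDiffAt 𝓘(ℝ, E) 𝓘(ℝ, E) ∞ c (ι (d.symm x)) :=
    contMDiffAt_of_mem_maximalAtlas (IsManifold.subset_maximalAtlas hc) hxc
  have hdx : ContMDiffAt 𝓘(ℝ, F) 𝓘(ℝ, F) ∞ d.symm x :=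
    contMDiffAt_symm_of_mem_maximalAtlas (IsManifold.subset_maximalAtlas hd) hx
  exact (hcι.comp x (hι.contMDiffAt.comp x hdx)).contDiffAt

theorem metricInChart_inducedMetric (hι : MDifferentiable 𝓘(ℝ, F) 𝓘(ℝ, E) ι) :
    metricInChart d (inducedMetric g ι) x =
      pullbackMetric (metricInChart c g.inner) (c ∘ ι ∘ d.symm) x := by
  have hcd := mdifferentiable_of_mem_atlas (I := 𝓘(ℝ, E)) hc
  have hdd := mdifferentiable_of_mem_atlas (I := 𝓘(ℝ, F)) hd
  ext v w
  rw [pullbackMetric, pullback_apply]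
  have h := metricInChart_fderiv_coord hdd hx hcd hι hxc g.inner (frameDeriv d ι x v) w
  rw [fderiv_coord hdd hx hcd hι hxc] at h ⊢
  exact h.symm

theorem IsMinimal.isMinimalAt_coord [FiniteDimensional ℝ F] (hmin : IsMinimal (F := F) g ι)
    (hι : MDifferentiable 𝓘(ℝ, F) 𝓘(ℝ, E) ι)
    (hinj : ∀ m, Function.Injective (mfderiv 𝓘(ℝ, F) 𝓘(ℝ, E) ι m)) :
    IsMinimalAt (metricInChart c g.inner) (c ∘ ι ∘ d.symm) x := by
  have hcd := mdifferentiable_of_mem_atlas (I := 𝓘(ℝ, E)) hc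
  have hdd := mdifferentiable_of_mem_atlas (I := 𝓘(ℝ, F)) hd
  have hdx : d (d.symm x) = x := d.right_inv hx
  intro ξ hξ
  obtain ⟨ζ, rfl⟩ : ∃ ζ, chartDeriv c (ι (d.symm x)) ζ = ξ := hcd.mfderiv_surjective hxc ξ
  have hnormal : ∀ v : TangentSpace 𝓘(ℝ, F) (d.symm x),
      g.inner (ι (d.symm x)) ζ (mfderiv 𝓘(ℝ, F) 𝓘(ℝ, E) ι (d.symm x) v) = 0 := by
    intro v
    obtain ⟨w, rfl⟩ := hdd.symm.mfderiv_surjective hx v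
    exact (metricInChart_fderiv_coord hdd hx hcd hι hxc g.inner ζ w).symm.trans (hξ w)
  have htrace := hmin (d.symm x) c hc hxc d hd (d.map_target hx) ζ hnormal
  have hchart := traceWrt_pullback_chartDeriv hdd
    (posDef_inducedMetric (g := g) hinj) (d.map_target hx)
    ((ContinuousLinearMap.postcomp F (metricInChart c g.inner ((c ∘ ι ∘ d.symm) x)
      (chartDeriv c (ι (d.symm x)) ζ))).comp (coordSecondDeriv c d g ι (d.symm x)))
  have h := hchart.symm.trans htrace
  rw [coordSecondDeriv, hdx] at h
  rw [← metricInChart_inducedMetric hc hd hx hxc hι]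
  exact h

end ImmersionsInCharts

/-! ### Restriction to minimal submanifolds -/

section Restriction

theorem eventually_mem_charts {E F X M : Type*} [TopologicalSpace E] [TopologicalSpace F]
    [TopologicalSpace X] [ChartedSpace E X] [TopologicalSpace M] {d : OpenPartialHomeomorph M F}
    {ι : M → X} (hι : Continuous ι) {a : F} (ha : a ∈ d.target) :
    ∀ᶠ x in 𝓝 a, x ∈ d.target ∧ ι (d.symm x) ∈ (chartAt E (ι (d.symm a))).source :=
  (d.open_target.eventually_mem ha).and <|
    (hι.continuousAt.comp (d.continuousAt_symm ha)).eventually (chart_source_mem_nhds E _)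

theorem IsTestFunction.comp_chart {E F X M : Type*} [TopologicalSpace E] [NormedAddCommGroup F]
    [NormedSpace ℝ F] [TopologicalSpace X] [TopologicalSpace M] [ChartedSpace F M]
    [IsManifold 𝓘(ℝ, F) ∞ M] {u : X → EReal} {ι : M → X} {d : OpenPartialHomeomorph M F}
    {φ : M → ℝ} {m : M} (hφ : IsTestFunction (E := F) (u ∘ ι) φ m) (hd : d ∈ atlas F M)
    (hm : m ∈ d.source) (hι : Continuous ι) {c : OpenPartialHomeomorph X E}
    (hc : ι m ∈ c.source) :
    IsTestFunction (E := F) ((u ∘ c.symm) ∘ c ∘ ι ∘ d.symm) (φ ∘ d.symm) (d m) := by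
  have hdm : d m ∈ d.target := d.map_source hm
  rw [← d.left_inv hm] at hφ hc
  refine (hφ.comp (contMDiffAt_symm_of_mem_maximalAtlas (IsManifold.subset_maximalAtlas hd)
    hdm)).congr ?_
  filter_upwards [(hι.continuousAt.comp (d.continuousAt_symm hdm)).eventually
    (c.eventually_left_inverse hc)] with x hx
  simp only [Function.comp_apply] at hx ⊢
  rw [hx]

variable {E F : Type*} [NormedAddCommGroup E] [NormedSpace ℝ E]
  [NormedAddCommGroup F] [NormedSpace ℝ F]
  {X : Type*} [TopologicalSpace X] [ChartedSpace E X] [IsManifold 𝓘(ℝ, E) ∞ X]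
  {M : Type*} [TopologicalSpace M] [ChartedSpace F M]
  {g : Bundle.ContMDiffRiemannianMetric 𝓘(ℝ, E) ∞ E (fun x : X => TangentSpace 𝓘(ℝ, E) x)}
  {p : ℕ} {𝒢 : Set (GrassmannBundle E X p)} {u : X → EReal} {ι : M → X}
  {d : OpenPartialHomeomorph M F}

theorem IsGSubmanifold.chartPlane_mem_fibre (hι : IsGSubmanifold (F := F) 𝒢 ι)
    (hd : d.MDifferentiable 𝓘(ℝ, F) 𝓘(ℝ, F)) {x₀ : X} {x : F} (hx : x ∈ d.target)
    (hxc : ι (d.symm x) ∈ (chartAt E x₀).source) :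
    chartPlane x₀ ((chartAt E x₀).symm ((chartAt E x₀ ∘ ι ∘ d.symm) x))
      (fderiv ℝ (chartAt E x₀ ∘ ι ∘ d.symm) x) ∈
        fibre 𝒢 ((chartAt E x₀).symm ((chartAt E x₀ ∘ ι ∘ d.symm) x)) := by
  have hframe : (chartFrame x₀ (ι (d.symm x))).comp (fderiv ℝ (chartAt E x₀ ∘ ι ∘ d.symm) x) =
      frameDeriv d ι x := by
    rw [fderiv_coord hd hx (mdifferentiable_chart x₀) (hι.contMDiff.mdifferentiable (by simp)) hxc]
    ext1 v
    exact chartFrame_chartDeriv hxc (frameDeriv d ι x v)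
  have htangent : chartPlane x₀ (ι (d.symm x)) (fderiv ℝ (chartAt E x₀ ∘ ι ∘ d.symm) x) ∈
      fibre 𝒢 (ι (d.symm x)) := by
    rw [chartPlane, hframe, range_frameDeriv hd hx]
    exact hι.tangent_mem _
  have hleft : (chartAt E x₀).symm ((chartAt E x₀ ∘ ι ∘ d.symm) x) = ι (d.symm x) :=
    (chartAt E x₀).left_inv hxc
  rwa [hleft]

variable [FiniteDimensional ℝ E]

theorem IsPlurisubharmonic.planeLaplacian_nonneg (hu : IsPlurisubharmonic g 𝒢 u)
    {c : OpenPartialHomeomorph X E} (hc : c ∈ atlas E X) {z : E} (hz : z ∈ c.target)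
    {W : Submodule ℝ (TangentSpace 𝓘(ℝ, E) (c.symm z))} (hW : W ∈ fibre 𝒢 (c.symm z))
    {P : E → E →L[ℝ] E} (hP : P z = orthProj (metricInChart c g.inner z)
      (W.map (chartDeriv c (c.symm z) : TangentSpace 𝓘(ℝ, E) (c.symm z) →ₗ[ℝ] E)))
    {Ψ : E → ℝ} (hΨ : IsTestFunction (E := E) (u ∘ c.symm) Ψ z) :
    0 ≤ planeLaplacian (metricInChart c g.inner) P Ψ z := by
  have hcd := mdifferentiable_of_mem_atlas (I := 𝓘(ℝ, E)) hc
  have hpos : ∀ x, PosDef (g.inner x) := fun x => g.pos x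
  have hxs : c.symm z ∈ c.source := c.map_target hz
  have hzc : c (c.symm z) = z := c.right_inv hz
  have htest : IsTestFunction (E := E) u (Ψ ∘ c) (c.symm z) := by
    rw [← hzc] at hΨ
    refine (hΨ.comp (contMDiffAt_of_mem_maximalAtlas (IsManifold.subset_maximalAtlas hc)
      hxs)).congr ?_
    filter_upwards [c.eventually_left_inverse hxs] with y hy
    simp only [Function.comp_apply, hy]
  have hcongr : (Ψ ∘ c) ∘ c.symm =ᶠ[𝓝 z] Ψ := by
    filter_upwards [c.eventually_right_inverse hz] with y hy
    simp only [Function.comp_apply, hy]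
  have h := hu.trace_nonneg _ _ htest c hc hxs W hW
  rwa [traceOn_hessian hcd hpos hxs, hzc, coordHessian_congr .rfl hcongr,
    ← planeLaplacian_eq_traceOn (posDef_metricInChart hcd hpos hz) hP] at h

omit [FiniteDimensional ℝ E] in
theorem IsGSubmanifold.eventually_injective_fderiv_coord (hι : IsGSubmanifold (F := F) 𝒢 ι)
    (hd : d.MDifferentiable 𝓘(ℝ, F) 𝓘(ℝ, F)) {a : F} (ha : a ∈ d.target) :
    ∀ᶠ x in 𝓝 a, Function.Injective
      (fderiv ℝ (chartAt E (ι (d.symm a)) ∘ ι ∘ d.symm) x) := by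
  have hc := mdifferentiable_chart (I := 𝓘(ℝ, E)) (ι (d.symm a))
  filter_upwards [eventually_mem_charts (E := E) hι.contMDiff.continuous ha] with x ⟨hx, hxc⟩
  rw [fderiv_coord hd hx hc (hι.contMDiff.mdifferentiable (by simp)) hxc]
  exact (chartDeriv_injective hc hxc).comp (frameDeriv_injective hd hx (hι.injective_mfderiv _))

variable [FiniteDimensional ℝ F]

theorem IsGSubmanifold.exists_projection (hretr : HasSmoothFibrewiseRetraction g 𝒢)
    (hι : IsGSubmanifold (F := F) 𝒢 ι) (hd : d.MDifferentiable 𝓘(ℝ, F) 𝓘(ℝ, F))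
    {a : F} (ha : a ∈ d.target) {c : OpenPartialHomeomorph X E}
    (hc : chartAt E (ι (d.symm a)) = c) (hf : ContDiffAt ℝ ∞ (c ∘ ι ∘ d.symm) a) {r : E → F}
    (hr : ContDiffAt ℝ ∞ r ((c ∘ ι ∘ d.symm) a))
    (hrf : ∀ᶠ x in 𝓝 a, r ((c ∘ ι ∘ d.symm) x) = x) :
    ∃ P : E → E →L[ℝ] E, ContDiffAt ℝ ∞ P ((c ∘ ι ∘ d.symm) a) ∧
      (∀ᶠ z in 𝓝 ((c ∘ ι ∘ d.symm) a), ∃ W ∈ fibre 𝒢 (c.symm z),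
        P z = orthProj (metricInChart c g.inner z)
          (W.map (chartDeriv c (c.symm z) : TangentSpace 𝓘(ℝ, E) (c.symm z) →ₗ[ℝ] E))) ∧
      ∀ᶠ x in 𝓝 a, P ((c ∘ ι ∘ d.symm) x) =
        orthProj (metricInChart c g.inner ((c ∘ ι ∘ d.symm) x))
          (fderiv ℝ (c ∘ ι ∘ d.symm) x).range := by
  subst hc
  set f := chartAt E (ι (d.symm a)) ∘ ι ∘ d.symm
  have hcharts := eventually_mem_charts (E := E) hι.contMDiff.continuous ha
  have hra : r (f a) = a := hrf.self_of_nhds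
  have hplane : ContDiffAt ℝ ∞ (fun z => fderiv ℝ f (r z)) (f a) :=
    ContDiffAt.comp _ (hra.symm ▸ hf.fderiv_right le_rfl) hr
  have hinj : ∀ᶠ z in 𝓝 (f a), Function.Injective (fderiv ℝ f (r z)) :=
    hr.continuousAt.eventually (by rw [hra]; exact hι.eventually_injective_fderiv_coord hd ha)
  have hmem := hι.chartPlane_mem_fibre hd ha hcharts.self_of_nhds.2
  obtain ⟨P, hP, hPz⟩ := hretr.exists_projection hplane hinj
    (by rwa [show r (chartAt E _ (ι (d.symm a))) = a from hra])
  refine ⟨P, hP, hPz.mono fun z hz => hz.1, ?_⟩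
  filter_upwards [hf.continuousAt.eventually hPz, hrf, hcharts] with x ⟨_, hx⟩ hrx ⟨hxd, hxc⟩
  rw [hrx] at hx
  exact hx (hι.chartPlane_mem_fibre hd hxd hxc)

variable [IsManifold 𝓘(ℝ, F) ∞ M]

theorem IsGSubmanifold.exists_minimalImmersionGerm (hretr : HasSmoothFibrewiseRetraction g 𝒢)
    (hι : IsGSubmanifold (F := F) 𝒢 ι) (hmin : IsMinimal (F := F) g ι) (hd : d ∈ atlas F M)
    {a : F} (ha : a ∈ d.target) {c : OpenPartialHomeomorph X E}
    (hc : chartAt E (ι (d.symm a)) = c) :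
    ∃ r P, MinimalImmersionGerm (metricInChart c g.inner) (c ∘ ι ∘ d.symm) r P a ∧
      ∀ᶠ z in 𝓝 ((c ∘ ι ∘ d.symm) a), ∃ W ∈ fibre 𝒢 (c.symm z),
        P z = orthProj (metricInChart c g.inner z)
          (W.map (chartDeriv c (c.symm z) : TangentSpace 𝓘(ℝ, E) (c.symm z) →ₗ[ℝ] E)) := by
  have hca : c ∈ atlas E X := hc ▸ chart_mem_atlas E _
  have hdd := mdifferentiable_of_mem_atlas (I := 𝓘(ℝ, F)) hd
  have hιd : MDifferentiable 𝓘(ℝ, F) 𝓘(ℝ, E) ι := hι.contMDiff.mdifferentiable (by simp)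
  have hcharts : ∀ᶠ x in 𝓝 a, x ∈ d.target ∧ ι (d.symm x) ∈ c.source :=
    hc ▸ eventually_mem_charts hι.contMDiff.continuous ha
  have hnhds : c.target ∈ 𝓝 ((c ∘ ι ∘ d.symm) a) := hc ▸ chart_target_mem_nhds E _
  have hf := contDiffAt_coord hca hd ha hcharts.self_of_nhds.2 hι.contMDiff
  have hinj : ∀ᶠ x in 𝓝 a, Function.Injective (fderiv ℝ (c ∘ ι ∘ d.symm) x) :=
    hc ▸ hι.eventually_injective_fderiv_coord hdd ha
  obtain ⟨r, hr, hrf⟩ := exists_contDiffAt_leftInverse hf (by simp) hinj.self_of_nhds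
  obtain ⟨P, hP, hP𝒢, hPf⟩ := hι.exists_projection hretr hdd ha hc hf hr hrf
  refine ⟨r, P, ?_, hP𝒢⟩
  exact
    { metric := hc ▸ ((contDiffOn_metricInChart g _).contDiffAt
        (chart_target_mem_nhds E _)).of_le ENat.LEInfty.out
      pos := mem_of_superset hnhds fun z hz =>
        posDef_metricInChart (mdifferentiable_of_mem_atlas hca) (fun x => g.pos x) hz
      symm := .of_forall fun z v w => g.symm _ _ _
      immersion := hf.of_le ENat.LEInfty.out
      injective := hinj
      minimal := hcharts.mono fun x hx =>
        hmin.isMinimalAt_coord hca hd hx.1 hx.2 hιd hι.injective_mfderiv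
      leftInv := hr.of_le ENat.LEInfty.out
      leftInv_apply := hrf
      proj := hP.of_le ENat.LEInfty.out
      proj_eq_orthProj := hP𝒢.mono fun z ⟨_, _, hz⟩ => ⟨_, hz⟩
      proj_tangent := hPf }

theorem IsPlurisubharmonic.laplacian_nonneg (hu : IsPlurisubharmonic g 𝒢 u)
    (hretr : HasSmoothFibrewiseRetraction g 𝒢)
    (hι : IsGSubmanifold (F := F) 𝒢 ι) (hmin : IsMinimal (F := F) g ι)
    {φ : M → ℝ} {m : M} (hφ : IsTestFunction (E := F) (u ∘ ι) φ m)
    (hd : d ∈ atlas F M) (hm : m ∈ d.source) :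
    0 ≤ laplacian d (inducedMetric g ι) φ m := by
  set c := chartAt E (ι (d.symm (d m))) with hc
  have hca : c ∈ atlas E X := chart_mem_atlas E _
  have hdm : d m ∈ d.target := d.map_source hm
  have hιd : MDifferentiable 𝓘(ℝ, F) 𝓘(ℝ, E) ι := hι.contMDiff.mdifferentiable (by simp)
  obtain ⟨r, P, hgerm, hP⟩ := hι.exists_minimalImmersionGerm hretr hmin hd hdm hc.symm
  have hcharts := eventually_mem_charts (E := E) hι.contMDiff.continuous hdm
  have hmetric : metricInChart d (inducedMetric g ι) =ᶠ[𝓝 (d m)]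
      pullbackMetric (metricInChart c g.inner) (c ∘ ι ∘ d.symm) :=
    hcharts.mono fun x hx => metricInChart_inducedMetric hca hd hx.1 hx.2 hιd
  have htarget : ∀ᶠ z in 𝓝 ((c ∘ ι ∘ d.symm) (d m)), z ∈ c.target := chart_target_mem_nhds E _
  have htest : IsTestFunction (E := F) ((u ∘ c.symm) ∘ c ∘ ι ∘ d.symm) (φ ∘ d.symm) (d m) :=
    hφ.comp_chart hd hm hι.contMDiff.continuous (d.left_inv hm ▸ hcharts.self_of_nhds.2)
  rw [laplacian_eq (mdifferentiable_of_mem_atlas hd) (posDef_inducedMetric hι.injective_mfderiv) hm,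
    coordHessian_congr hmetric .rfl, hmetric.self_of_nhds]
  refine hgerm.laplacian_nonneg ?_ (.of_forall fun z => hu.usc.ne_top _) ?_ htest
  · filter_upwards [htarget] with z hz y hy
    exact (c.continuousAt_symm hz).eventually (hu.usc.upperSemicontinuous _ y hy)
  · filter_upwards [hP, htarget] with z ⟨W, hW, hPW⟩ hz Ψ hΨ
    exact hu.planeLaplacian_nonneg hca hz hW hPW hΨ

end Restriction

theorem IsUSC.comp {X Y : Type*} [TopologicalSpace X] [TopologicalSpace Y] {u : X → EReal}
    (hu : IsUSC u) {k : Y → X} (hk : Continuous k) : IsUSC (u ∘ k) :=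
  ⟨hu.upperSemicontinuous.comp hk, fun y => hu.ne_top (k y)⟩

end Pluri

end

theorem theorem6p7_general {E : Type*} [NormedAddCommGroup E] [NormedSpace ℝ E]
    [FiniteDimensional ℝ E] {X : Type*} [TopologicalSpace X] [ChartedSpace E X]
    [IsManifold 𝓘(ℝ, E) ∞ X]
    (g : Bundle.ContMDiffRiemannianMetric 𝓘(ℝ, E) ∞ E (fun x : X => TangentSpace 𝓘(ℝ, E) x))
    {p : ℕ} (𝒢 : Set (Pluri.GrassmannBundle E X p))
    (hretr : Pluri.HasSmoothFibrewiseRetraction g 𝒢)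
    (u : X → EReal) (hu : Pluri.IsPlurisubharmonic g 𝒢 u)
    {F : Type*} [NormedAddCommGroup F] [NormedSpace ℝ F] [FiniteDimensional ℝ F]
    {M : Type*} [TopologicalSpace M] [ChartedSpace F M] [IsManifold 𝓘(ℝ, F) ∞ M]
    (ι : M → X) (hι : Pluri.IsGSubmanifold (F := F) 𝒢 ι)
    (hmin : Pluri.IsMinimal (F := F) g ι) :
    Pluri.IsSubharmonic (Pluri.inducedMetric (F := F) g ι) (fun m => u (ι m)) where
  usc := hu.usc.comp hι.contMDiff.continuous
  laplacian_nonneg _ _ hφ _ hd hm := hu.laplacian_nonneg hretr hι hmin hφ hd hm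

theorem theorem6p7
    {n p : ℕ} (hp : 1 ≤ p) (hpn : p ≤ n)
    {X : Type*} [TopologicalSpace X] [ChartedSpace (EuclideanSpace ℝ (Fin n)) X]
    [IsManifold 𝓘(ℝ, EuclideanSpace ℝ (Fin n)) ∞ X]
    (g : Bundle.ContMDiffRiemannianMetric 𝓘(ℝ, EuclideanSpace ℝ (Fin n)) ∞ (EuclideanSpace ℝ (Fin n))
      (fun x : X => TangentSpace 𝓘(ℝ, EuclideanSpace ℝ (Fin n)) x))
    (𝒢 : Set (Pluri.GrassmannBundle (EuclideanSpace ℝ (Fin n)) X p))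
    (h𝒢 : IsClosed[Pluri.grassmannTopology g p] 𝒢)
    (hretr : Pluri.HasSmoothFibrewiseRetraction g 𝒢)
    (u : X → EReal) (hu : Pluri.IsPlurisubharmonic g 𝒢 u)
    {M : Type*} [TopologicalSpace M] [ChartedSpace (EuclideanSpace ℝ (Fin p)) M]
    [IsManifold 𝓘(ℝ, EuclideanSpace ℝ (Fin p)) ∞ M]
    (ι : M → X) (hι : Pluri.IsGSubmanifold (F := EuclideanSpace ℝ (Fin p)) 𝒢 ι)
    (hmin : Pluri.IsMinimal (F := EuclideanSpace ℝ (Fin p)) g ι) :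
    Pluri.IsSubharmonic (Pluri.inducedMetric (F := EuclideanSpace ℝ (Fin p)) g ι)
      (fun m => u (ι m)) :=
  theorem6p7_general g 𝒢 hretr u hu ι hι hmin
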